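/- Let $K$ be a field of characteristic $0$. Let $\mathbf C$ be the category of finite-dimensional, nilpotent, associative, graded-commutative, differential $\mathbb Z$-graded $K$-algebras without unit, with differential of degree $+1$; morphisms are degree-$0$ algebra homomorphisms commuting with the differentials. An object of $\mathbf C$ with zero product is called a complex. An acyclic small extension in $\mathbf C$ is a surjective morphism $A\to B$ whose kernel $I$ satisfies $AI=0$ and has zero cohomology. A functor $F:\mathbf C\to\mathbf{Set}$ is a *predeformation functor* if: (1) $F(0)$ is a one-point set; (2) for all morphisms $\alpha:A\to C$, $\beta:B\to C$ in $\mathbf C$ with $\alpha$ surjective, the natural map $F(A\times_CB)\to F(A)\times_{F(C)}F(B)$ is surjective, and it is bijective if moreover $C$ is an acyclic complex; (3) $F(A)\to F(B)$ is surjective for every acyclic small extension $A\to B$. It is a *deformation functor* if in addition $F(A)\to F(B)$ is bijective for every acyclic small extension $A\to B$. Morphisms of (pre)deformation functors are natural transformations. For a predeformation functor $F$ and a complex $A\in\mathbf C$, the set $F(A)$ is a $K$-vector space, with sum $F(A)\times F(A)\cong F(A\times A)\to F(A)$ induced by $+:A\times A\to A$, and with multiplication by $s\in K$ induced by $s:A\to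 A$. Let $K[n]\in\mathbf C$ be the field $K$ placed in degree $-n$, with zero differential and zero product. For a deformation functor $F$ put $T^iF=F(K[i-1])$; the tangent space $TF[1]$ is the graded vector space with $TF[1]^i=T^{i+1}F$ for $i\in\mathbb Z$. A morphism $F\to G$ of deformation functors induces a morphism $TF[1]\to TG[1]$ of graded vector spaces. **Theorem.** (a) A morphism $\theta:F\to G$ of predeformation functors is an isomorphism if and only if $\theta:F(A)\to G(A)$ is bijective for every complex $A\in\mathbf C$. (b) A morphism $\theta:F\to G$ of deformation functors is an isomorphism if and only if it induces an isomorphism of graded vector spaces $TF[1]\to TG[1]$. -/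

import Mathlib

open CategoryTheory

universe v u

namespace ExtDef

/-- `power K A n` is the power `A^{n+1}` of an algebra without unit: `power K A 0 = A`, and
`power K A (n + 1)` is spanned by the products `x * y` with `x ∈ A` and `y ∈ power K A n`. -/
def power (K : Type u) (A : Type u) [Field K] [NonUnitalRing A] [Module K A] :
    ℕ → Submodule K A
  | 0 => ⊤
  | n + 1 => Submodule.span K {z | ∃ x : A, ∃ y ∈ power K A n, z = x * y}

/-- The objects of the category `C`: finite-dimensional nilpotent (associative, graded-commutative)
differential `ℤ`-graded `K`-algebras, with differential of degree `+1`. The grading is internal: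
`gr i` is the homogeneous part of degree `i`. -/
structure NilpDGA (K : Type u) [Field K] where
  carrier : Type u
  [ring : NonUnitalRing carrier]
  [module : Module K carrier]
  [scalarTower : IsScalarTower K carrier carrier]
  [smulComm : SMulCommClass K carrier carrier]
  [finite : FiniteDimensional K carrier]
  /-- The homogeneous parts. -/
  gr : ℤ → Submodule K carrier
  isInternal : DirectSum.IsInternal gr
  mul_mem : ∀ {i j : ℤ} {a b : carrier}, a ∈ gr i → b ∈ gr j → a * b ∈ gr (i + j)
  /-- `ab = (-1)^{ij} ba` for `a`, `b` homogeneous of degrees `i`, `j`. -/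
  graded_comm : ∀ {i j : ℤ} {a b : carrier}, a ∈ gr i → b ∈ gr j →
    a * b = (i * j).negOnePow • (b * a)
  /-- The differential. -/
  d : carrier →ₗ[K] carrier
  d_mem : ∀ {i : ℤ} {a : carrier}, a ∈ gr i → d a ∈ gr (i + 1)
  d_d : ∀ a : carrier, d (d a) = 0
  /-- `d(ab) = d(a)b + (-1)^i a d(b)` for `a` homogeneous of degree `i`. -/
  leibniz : ∀ {i : ℤ} {a : carrier} (b : carrier), a ∈ gr i →
    d (a * b) = d a * b + i.negOnePow • (a * d b)
  nilpotent : ∃ n : ℕ, power K carrier n = ⊥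

namespace NilpDGA

variable {K : Type u} [Field K]

instance : CoeSort (NilpDGA K) (Type u) := ⟨carrier⟩

attribute [instance] ring module scalarTower smulComm finite

/-- Morphisms of dg-algebras: algebra morphisms of degree `0` which commute with differentials. -/
@[ext]
structure Hom (A B : NilpDGA K) where
  toAlgHom : A →ₙₐ[K] B
  map_gr : ∀ {i : ℤ} {a : A}, a ∈ A.gr i → toAlgHom a ∈ B.gr i
  map_d : ∀ a : A, toAlgHom (A.d a) = B.d (toAlgHom a)

instance : Category (NilpDGA K) where
  Hom := Hom
  id A := ⟨NonUnitalAlgHom.id K A, fun h => h, fun _ => rfl⟩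
  comp f g := ⟨g.toAlgHom.comp f.toAlgHom, fun h => g.map_gr (f.map_gr h),
    fun a => by simp [f.map_d, g.map_d]⟩

/-- The underlying map of a morphism in `C`. -/
def app {A B : NilpDGA K} (f : A ⟶ B) : A →ₙₐ[K] B := Hom.toAlgHom f

theorem app_gr {A B : NilpDGA K} (f : A ⟶ B) {i : ℤ} {a : A} (h : a ∈ A.gr i) :
    app f a ∈ B.gr i := Hom.map_gr f h

theorem app_d {A B : NilpDGA K} (f : A ⟶ B) (a : A) : app f (A.d a) = B.d (app f a) :=
  Hom.map_d f a

theorem hom_ext {A B : NilpDGA K} {f g : A ⟶ B} (h : ∀ a, app f a = app g a) : f = g :=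
  Hom.ext (NonUnitalAlgHom.ext h)

@[simp] theorem app_id (A : NilpDGA K) (a : A) : app (𝟙 A) a = a := rfl

@[simp] theorem app_comp {A B C : NilpDGA K} (f : A ⟶ B) (g : B ⟶ C) (a : A) :
    app (f ≫ g) a = app g (app f a) := rfl

/-- `A` belongs to `C ∩ DG`: it has zero product, that is, it is just a complex. -/
def IsComplex (A : NilpDGA K) : Prop := ∀ a b : A, a * b = 0

/-- `A` has zero cohomology: every cocycle is a coboundary. -/
def IsAcyclic (A : NilpDGA K) : Prop := ∀ a : A, A.d a = 0 → ∃ b : A, A.d b = a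

/-- `α : A ⟶ B` is the projection of an acyclic small extension `0 → I → A → B → 0`:
`α` is surjective, and its kernel `I` satisfies `A I = 0` and is an acyclic complex. -/
structure IsAcyclicSmallExtension {A B : NilpDGA K} (α : A ⟶ B) : Prop where
  surjective : Function.Surjective (app α)
  mul_ker : ∀ a x : A, app α x = 0 → a * x = 0
  acyclic_ker : ∀ x : A, app α x = 0 → A.d x = 0 → ∃ y : A, app α y = 0 ∧ A.d y = x

section Constructions

theorem map_power {A B : Type u} [NonUnitalRing A] [Module K A] [NonUnitalRing B] [Module K B]
    (f : A →ₙₐ[K] B) (n : ℕ) {a : A} (ha : a ∈ power K A n) : f a ∈ power K B n := by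
  induction n generalizing a with
  | zero => exact Submodule.mem_top
  | succ n ih =>
    refine Submodule.span_induction (p := fun a _ => f a ∈ power K B (n + 1)) ?_ ?_ ?_ ?_ ha
    · rintro _ ⟨x, y, hy, rfl⟩
      exact Submodule.subset_span ⟨f x, f y, ih hy, map_mul f x y⟩
    · simp
    · intro x y _ _ hx hy
      rw [map_add]
      exact add_mem hx hy
    · intro r x _ hx
      rw [map_smul]
      exact Submodule.smul_mem _ r hx

theorem power_antitone (A : Type u) [NonUnitalRing A] [Module K A] :
    Antitone (power K A) := by
  refine antitone_nat_of_succ_le fun n => ?_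
  induction n with
  | zero => exact le_top
  | succ n ih =>
    refine Submodule.span_mono ?_
    rintro _ ⟨x, y, hy, rfl⟩
    exact ⟨x, y, ih hy, rfl⟩

/-- The zero algebra. -/
def zero (K : Type u) [Field K] : NilpDGA K where
  carrier := PUnit.{u + 1}
  gr _ := ⊤
  isInternal := by
    refine (DirectSum.isInternal_submodule_iff_iSupIndep_and_iSup_eq_top _).2 ⟨?_, ?_⟩
    · intro i
      exact Submodule.disjoint_def.2 fun _ _ _ => rfl
    · exact Subsingleton.elim _ _
  mul_mem _ _ := trivial
  graded_comm _ _ := rfl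
  d := 0
  d_mem _ := trivial
  d_d _ := rfl
  leibniz _ _ := rfl
  nilpotent := ⟨0, Subsingleton.elim _ _⟩

/-- The zero morphism. -/
def zeroHom (A B : NilpDGA K) : A ⟶ B :=
  Hom.mk 0 (fun _ => Submodule.zero_mem _) (fun _ => (map_zero B.d).symm)

@[simp] theorem app_zeroHom (A B : NilpDGA K) (a : A) : app (zeroHom A B) a = 0 := rfl

/-- Every element is a finite sum of homogeneous components. -/
theorem exists_components (A : NilpDGA K) :
    ∃ p : ℤ → A →ₗ[K] A, (∀ i a, p i a ∈ A.gr i) ∧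
      (∀ i a, a ∈ A.gr i → ∀ j, p j a = if i = j then a else 0) ∧
      ∀ a, ∃ s : Finset ℤ, ∀ t : Finset ℤ, s ⊆ t → ∑ i ∈ t, p i a = a := by
  classical
  let _ := A.isInternal.chooseDecomposition
  refine ⟨fun i => (A.gr i).subtype ∘ₗ DirectSum.component K ℤ (fun i => A.gr i) i ∘ₗ
    (DirectSum.decomposeLinearEquiv A.gr).toLinearMap, ?_, ?_, ?_⟩
  · intro i a
    exact Subtype.prop _
  · intro i a ha j
    split_ifs with h
    · subst h
      exact DirectSum.decompose_of_mem_same A.gr ha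
    · exact DirectSum.decompose_of_mem_ne A.gr ha h
  · intro a
    refine ⟨(DirectSum.decompose A.gr a).support, fun t ht => ?_⟩
    rw [← Finset.sum_subset ht]
    · exact DirectSum.sum_support_decompose A.gr a
    · intro i _ hi
      have h0 : DirectSum.decompose A.gr a i = 0 := DFinsupp.notMem_support_iff.1 hi
      change ((DirectSum.decompose A.gr a i : A.gr i) : A) = 0
      rw [h0]
      rfl

/-- A morphism in `C` commutes with taking homogeneous components. -/
theorem app_component {A B : NilpDGA K} (f : A ⟶ B) {p : ℤ → A →ₗ[K] A} {q : ℤ → B →ₗ[K] B}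
    (hp : ∀ i a, p i a ∈ A.gr i)
    (hs : ∀ a, ∃ s : Finset ℤ, ∀ t : Finset ℤ, s ⊆ t → ∑ i ∈ t, p i a = a)
    (hq : ∀ i b, b ∈ B.gr i → ∀ j, q j b = if i = j then b else 0) (i : ℤ) (a : A) :
    app f (p i a) = q i (app f a) := by
  classical
  obtain ⟨s, h⟩ := hs a
  have h1 := h (insert i s) (Finset.subset_insert i s)
  conv_rhs => rw [← h1]
  rw [map_sum, map_sum, Finset.sum_eq_single i]
  · rw [hq i _ (app_gr f (hp i a)), if_pos rfl]
  · intro j _ hj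
    rw [hq j _ (app_gr f (hp j a)), if_neg hj]
  · intro hi
    exact absurd (Finset.mem_insert_self i s) hi

variable {A B C : NilpDGA K} (α : A ⟶ C) (β : B ⟶ C)

/-- The subalgebra `{(a, b) | α a = β b}` of `A × B`. -/
def fiberSubalgebra : NonUnitalSubalgebra K (A × B) where
  carrier := {p | app α p.1 = app β p.2}
  add_mem' {x y} hx hy := by
    simp only [Set.mem_ofPred_eq] at hx hy
    simp [hx, hy]
  zero_mem' := by simp
  mul_mem' {x y} hx hy := by
    simp only [Set.mem_ofPred_eq] at hx hy
    simp [hx, hy]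
  smul_mem' r x hx := by
    simp only [Set.mem_ofPred_eq] at hx
    simp [hx]

theorem mem_fiberSubalgebra {p : A × B} : p ∈ fiberSubalgebra α β ↔ app α p.1 = app β p.2 :=
  Iff.rfl

/-- The homogeneous parts of the fibre product. -/
def fiberGr (i : ℤ) : Submodule K (fiberSubalgebra α β) where
  carrier := {p | p.1.1 ∈ A.gr i ∧ p.1.2 ∈ B.gr i}
  add_mem' hx hy := ⟨add_mem hx.1 hy.1, add_mem hx.2 hy.2⟩
  zero_mem' := ⟨zero_mem _, zero_mem _⟩
  smul_mem' r _ hx := ⟨Submodule.smul_mem _ r hx.1, Submodule.smul_mem _ r hx.2⟩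

/-- The first projection of the fibre product. -/
def fiberFst : fiberSubalgebra α β →ₙₐ[K] A :=
  (NonUnitalAlgHom.fst K A B).comp (NonUnitalSubalgebraClass.subtype (fiberSubalgebra α β))

/-- The second projection of the fibre product. -/
def fiberSnd : fiberSubalgebra α β →ₙₐ[K] B :=
  (NonUnitalAlgHom.snd K A B).comp (NonUnitalSubalgebraClass.subtype (fiberSubalgebra α β))

theorem fiberGr_isInternal : DirectSum.IsInternal (fiberGr α β) := by
  classical
  refine (DirectSum.isInternal_submodule_iff_iSupIndep_and_iSup_eq_top _).2 ⟨?_, ?_⟩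
  · have hA := ((DirectSum.isInternal_submodule_iff_iSupIndep_and_iSup_eq_top _).1 A.isInternal).1
    have hB := ((DirectSum.isInternal_submodule_iff_iSupIndep_and_iSup_eq_top _).1 B.isInternal).1
    intro i
    refine Submodule.disjoint_def.2 fun x hx hx' => ?_
    have h1 : (⨆ j, ⨆ (_ : j ≠ i), fiberGr α β j) ≤
        (⨆ j, ⨆ (_ : j ≠ i), A.gr j).comap (fiberFst α β : fiberSubalgebra α β →ₗ[K] A) :=
      iSup₂_le fun j hj y hy =>
        (le_iSup₂_of_le (f := fun j (_ : j ≠ i) => A.gr j) j hj le_rfl : A.gr j ≤ _) hy.1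
    have h2 : (⨆ j, ⨆ (_ : j ≠ i), fiberGr α β j) ≤
        (⨆ j, ⨆ (_ : j ≠ i), B.gr j).comap (fiberSnd α β : fiberSubalgebra α β →ₗ[K] B) :=
      iSup₂_le fun j hj y hy =>
        (le_iSup₂_of_le (f := fun j (_ : j ≠ i) => B.gr j) j hj le_rfl : B.gr j ≤ _) hy.2
    exact Subtype.ext (Prod.ext (Submodule.disjoint_def.1 (hA i) _ hx.1 (h1 hx'))
      (Submodule.disjoint_def.1 (hB i) _ hx.2 (h2 hx')))
  · obtain ⟨p, hp, hp', hps⟩ := A.exists_components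
    obtain ⟨q, hq, hq', hqs⟩ := B.exists_components
    obtain ⟨r, hr, hr', hrs⟩ := C.exists_components
    refine eq_top_iff.2 fun x _ => ?_
    obtain ⟨s, hs⟩ := hps x.1.1
    obtain ⟨t, ht⟩ := hqs x.1.2
    have hc : ∀ i, (p i x.1.1, q i x.1.2) ∈ fiberSubalgebra α β := fun i => by
      rw [mem_fiberSubalgebra, app_component α hp hps hr', app_component β hq hqs hr']
      exact congrArg (r i) x.2
    have hx : x = ∑ i ∈ s ∪ t, (⟨_, hc i⟩ : fiberSubalgebra α β) := by
      refine Subtype.ext (Prod.ext ?_ ?_)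
      · have h := map_sum (fiberFst α β) (fun i => (⟨_, hc i⟩ : fiberSubalgebra α β)) (s ∪ t)
        exact (hs _ Finset.subset_union_left).symm.trans h.symm
      · have h := map_sum (fiberSnd α β) (fun i => (⟨_, hc i⟩ : fiberSubalgebra α β)) (s ∪ t)
        exact (ht _ Finset.subset_union_right).symm.trans h.symm
    rw [hx]
    exact Submodule.sum_mem _ fun i _ => Submodule.mem_iSup_of_mem i ⟨hp i _, hq i _⟩

/-- The fibre product `A ×_C B = {(a, b) | α a = β b}`, with componentwise operations. -/
def fiberProd : NilpDGA K where
  carrier := fiberSubalgebra α β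
  finite := inferInstanceAs (FiniteDimensional K (fiberSubalgebra α β).toSubmodule)
  gr := fiberGr α β
  isInternal := fiberGr_isInternal α β
  mul_mem ha hb := ⟨A.mul_mem ha.1 hb.1, B.mul_mem ha.2 hb.2⟩
  graded_comm ha hb :=
    Subtype.ext (Prod.ext (A.graded_comm ha.1 hb.1) (B.graded_comm ha.2 hb.2))
  d :=
    { toFun := fun x => ⟨(A.d x.1.1, B.d x.1.2), by
        rw [mem_fiberSubalgebra, app_d, app_d]
        exact congrArg C.d x.2⟩
      map_add' := fun x y => Subtype.ext (Prod.ext (map_add A.d _ _) (map_add B.d _ _))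
      map_smul' := fun r x => Subtype.ext (Prod.ext (map_smul A.d r _) (map_smul B.d r _)) }
  d_mem ha := ⟨A.d_mem ha.1, B.d_mem ha.2⟩
  d_d x := Subtype.ext (Prod.ext (A.d_d x.1.1) (B.d_d x.1.2))
  leibniz b ha := Subtype.ext (Prod.ext (A.leibniz b.1.1 ha.1) (B.leibniz b.1.2 ha.2))
  nilpotent := by
    obtain ⟨m, hm⟩ := A.nilpotent
    obtain ⟨n, hn⟩ := B.nilpotent
    refine ⟨m + n, eq_bot_iff.2 fun x hx => ?_⟩
    have h1 := power_antitone (K := K) A (Nat.le_add_right m n) (map_power (fiberFst α β) _ hx)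
    have h2 := power_antitone (K := K) B (Nat.le_add_left n m) (map_power (fiberSnd α β) _ hx)
    rw [hm] at h1
    rw [hn] at h2
    exact Subtype.ext (Prod.ext h1 h2)

/-- The projection `A ×_C B ⟶ A`. -/
def fst : fiberProd α β ⟶ A :=
  Hom.mk (fiberFst α β) (fun h => h.1) (fun _ => rfl)

/-- The projection `A ×_C B ⟶ B`. -/
def snd : fiberProd α β ⟶ B :=
  Hom.mk (fiberSnd α β) (fun h => h.2) (fun _ => rfl)

theorem fiber_condition : fst α β ≫ α = snd α β ≫ β :=
  hom_ext fun x => x.2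

/-- The morphism `X ⟶ A ×_C B` with components `f` and `g`. -/
def lift {X : NilpDGA K} (f : X ⟶ A) (g : X ⟶ B) (h : f ≫ α = g ≫ β) : X ⟶ fiberProd α β :=
  Hom.mk
    (NonUnitalAlgHom.codRestrict ((app f).prod (app g)) (fiberSubalgebra α β)
      (fun x => congrArg (fun k => app k x) h))
    (fun hx => ⟨app_gr f hx, app_gr g hx⟩)
    (fun x => Subtype.ext (Prod.ext (app_d f x) (app_d g x)))

theorem lift_fst {X : NilpDGA K} (f : X ⟶ A) (g : X ⟶ B) (h : f ≫ α = g ≫ β) :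
    lift α β f g h ≫ fst α β = f := rfl

theorem lift_snd {X : NilpDGA K} (f : X ⟶ A) (g : X ⟶ B) (h : f ≫ α = g ≫ β) :
    lift α β f g h ≫ snd α β = g := rfl

/-- The product `A × B`, as a fibre product over the zero algebra. -/
abbrev prod (A B : NilpDGA K) : NilpDGA K := fiberProd (zeroHom A (zero K)) (zeroHom B (zero K))

/-- The vector space underlying `K[n]`; its product is zero. -/
def ShiftCarrier (K : Type u) : Type u := K

instance : AddCommGroup (ShiftCarrier K) := inferInstanceAs (AddCommGroup K)

instance : Module K (ShiftCarrier K) := inferInstanceAs (Module K K)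

instance : FiniteDimensional K (ShiftCarrier K) := inferInstanceAs (FiniteDimensional K K)

instance : NonUnitalRing (ShiftCarrier K) where
  mul _ _ := 0
  left_distrib _ _ _ := (add_zero (0 : ShiftCarrier K)).symm
  right_distrib _ _ _ := (add_zero (0 : ShiftCarrier K)).symm
  zero_mul _ := rfl
  mul_zero _ := rfl
  mul_assoc _ _ _ := rfl

theorem shiftCarrier_mul (a b : ShiftCarrier K) : a * b = 0 := rfl

/-- The complex `K[n]`: the field `K` placed in degree `-n`, with zero differential and zero
product. -/
def shift (K : Type u) [Field K] (n : ℤ) : NilpDGA K where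
  carrier := ShiftCarrier K
  scalarTower := ⟨fun r _ _ => (smul_zero (A := ShiftCarrier K) r).symm⟩
  smulComm := ⟨fun r _ _ => smul_zero (A := ShiftCarrier K) r⟩
  gr i := if i + n = 0 then ⊤ else ⊥
  isInternal := by
    refine (DirectSum.isInternal_submodule_iff_iSupIndep_and_iSup_eq_top _).2 ⟨?_, ?_⟩
    · intro i
      by_cases hi : i + n = 0
      · have h : (⨆ j, ⨆ (_ : j ≠ i), (if j + n = 0 then ⊤ else ⊥ :
            Submodule K (ShiftCarrier K))) = ⊥ :=
          eq_bot_iff.2 (iSup₂_le fun j hj => by rw [if_neg (by omega)])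
        rw [h]
        exact disjoint_bot_right
      · change Disjoint (if i + n = 0 then ⊤ else ⊥) _
        rw [if_neg hi]
        exact disjoint_bot_left
    · refine eq_top_iff.2 (le_iSup_of_le (-n) ?_)
      rw [if_pos (by omega)]
  mul_mem _ _ := Submodule.zero_mem _
  graded_comm _ _ := (smul_zero _).symm
  d := 0
  d_mem _ := Submodule.zero_mem _
  d_d _ := rfl
  leibniz b _ := by simp [shiftCarrier_mul]
  nilpotent := by
    refine ⟨1, eq_bot_iff.2 (Submodule.span_le.2 ?_)⟩
    rintro _ ⟨x, y, _, rfl⟩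
    rfl

theorem shift_isComplex (n : ℤ) : (shift K n).IsComplex := fun _ _ => rfl

end Constructions

section Complex

variable {X Y A : NilpDGA K}

/-- The sum of two morphisms into an algebra with zero product. -/
def addHom (hA : A.IsComplex) (f g : X ⟶ A) : X ⟶ A :=
  Hom.mk
    { toFun := fun x => app f x + app g x
      map_smul' := fun r x => by simp
      map_zero' := by simp
      map_add' := fun x y => by simp only [map_add]; abel
      map_mul' := fun x y => by simp only [map_mul, hA _ _, add_zero] }
    (fun h => add_mem (app_gr f h) (app_gr g h))
    (fun x => by
      change app f (X.d x) + app g (X.d x) = A.d (app f x + app g x)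
      rw [app_d, app_d, map_add])

/-- A scalar multiple of a morphism into an algebra with zero product. -/
def smulHom (hA : A.IsComplex) (r : K) (f : X ⟶ A) : X ⟶ A :=
  Hom.mk
    { toFun := fun x => r • app f x
      map_smul' := fun s x => by simp [smul_comm r s]
      map_zero' := by simp
      map_add' := fun x y => by simp
      map_mul' := fun x y => by simp only [map_mul, hA _ _, smul_zero] }
    (fun h => Submodule.smul_mem _ r (app_gr f h))
    (fun x => by
      change r • app f (X.d x) = A.d (r • app f x)
      rw [app_d, map_smul])

@[simp] theorem app_addHom (hA : A.IsComplex) (f g : X ⟶ A) (x : X) :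
    app (addHom hA f g) x = app f x + app g x := rfl

@[simp] theorem app_smulHom (hA : A.IsComplex) (r : K) (f : X ⟶ A) (x : X) :
    app (smulHom hA r f) x = r • app f x := rfl

end Complex

end NilpDGA

open NilpDGA

variable {K : Type u} [Field K]

/-- The canonical map `η : F(A ×_C B) → F(A) ×_{F(C)} F(B)`. -/
def comparison (F : NilpDGA K ⥤ Type v) {A B C : NilpDGA K} (α : A ⟶ C) (β : B ⟶ C)
    (x : F.obj (fiberProd α β)) :
    {p : F.obj A × F.obj B // F.map α p.1 = F.map β p.2} :=
  ⟨(F.map (fst α β) x, F.map (snd α β) x), by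
    simp only [← Functor.map_comp_apply, fiber_condition]⟩

/-- Predeformation functors. -/
structure IsPredeformation (F : NilpDGA K ⥤ Type v) : Prop where
  /-- `F(0)` is a one-point set. -/
  zero : Nonempty (Unique (F.obj (NilpDGA.zero K)))
  /-- Generalized Schlessinger conditions. -/
  surjective : ∀ {A B C : NilpDGA K} (α : A ⟶ C) (β : B ⟶ C),
    Function.Surjective (app α) → Function.Surjective (comparison F α β)
  bijective : ∀ {A B C : NilpDGA K} (α : A ⟶ C) (β : B ⟶ C),
    Function.Surjective (app α) → C.IsComplex → C.IsAcyclic →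
      Function.Bijective (comparison F α β)
  /-- Quasismoothness. -/
  quasismooth : ∀ {A B : NilpDGA K} (α : A ⟶ B), IsAcyclicSmallExtension α →
    Function.Surjective (F.map α)

/-- Deformation functors. -/
structure IsDeformation (F : NilpDGA K ⥤ Type v) : Prop extends IsPredeformation F where
  bijective_of_acyclic : ∀ {A B : NilpDGA K} (α : A ⟶ B), IsAcyclicSmallExtension α →
    Function.Bijective (F.map α)

namespace IsPredeformation

variable {F G : NilpDGA K ⥤ Type v}

theorem prod_bijective (hF : IsPredeformation F) (A B : NilpDGA K) :
    Function.Bijective fun x : F.obj (NilpDGA.prod A B) =>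
      ((F.map (fst _ _) x, F.map (snd _ _) x) : F.obj A × F.obj B) := by
  obtain ⟨hz⟩ := hF.zero
  have h := hF.bijective (zeroHom A (NilpDGA.zero K)) (zeroHom B (NilpDGA.zero K))
    (fun _ => ⟨0, rfl⟩) (fun _ _ => rfl) (fun _ _ => ⟨0, rfl⟩)
  refine ⟨fun x y hxy => h.1 (Subtype.ext hxy), fun p => ?_⟩
  obtain ⟨x, hx⟩ := h.2 ⟨p, Subsingleton.elim _ _⟩
  exact ⟨x, congrArg Subtype.val hx⟩

/-- The inverse of the bijection `F(A × B) → F(A) × F(B)`. -/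
noncomputable def pair (hF : IsPredeformation F) {A B : NilpDGA K} (a : F.obj A) (b : F.obj B) :
    F.obj (NilpDGA.prod A B) :=
  (Equiv.ofBijective _ (hF.prod_bijective A B)).symm (a, b)

theorem pair_spec (hF : IsPredeformation F) {A B : NilpDGA K} (a : F.obj A) (b : F.obj B) :
    F.map (fst _ _) (hF.pair a b) = a ∧ F.map (snd _ _) (hF.pair a b) = b :=
  Prod.ext_iff.1 ((Equiv.ofBijective _ (hF.prod_bijective A B)).apply_symm_apply (a, b))

/-- The set `F(A)` for a complex `A`, to be equipped with its natural vector space structure. -/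
def Val (_ : IsPredeformation F) {A : NilpDGA K} (_ : A.IsComplex) : Type v := F.obj A

variable {A X : NilpDGA K}

/-- The map `Hom(X, A) → F(A)` given by an element of `F(X)`. -/
def ev (hF : IsPredeformation F) (hA : A.IsComplex) (x : F.obj X) (f : X ⟶ A) : hF.Val hA :=
  F.map f x

theorem exists_ev (hF : IsPredeformation F) (hA : A.IsComplex) (a b c : hF.Val hA) :
    ∃ (X : NilpDGA K) (x : F.obj X) (f g h : X ⟶ A),
      hF.ev hA x f = a ∧ hF.ev hA x g = b ∧ hF.ev hA x h = c := by
  obtain ⟨h1, h2⟩ := hF.pair_spec (A := A) (B := A) a b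
  obtain ⟨h3, h4⟩ := hF.pair_spec (A := NilpDGA.prod A A) (B := A) (hF.pair a b) c
  refine ⟨_, hF.pair (hF.pair a b) c, fst _ _ ≫ fst _ _, fst _ _ ≫ snd _ _, snd _ _, ?_, ?_, h4⟩
  · rw [ev, Functor.map_comp_apply, h3, h1]
  · rw [ev, Functor.map_comp_apply, h3, h2]

/-- The sum is `F(A) × F(A) = F(A × A) → F(A)`, induced by `+ : A × A ⟶ A`. -/
noncomputable instance (hF : IsPredeformation F) (hA : A.IsComplex) : Add (hF.Val hA) :=
  ⟨fun a b => F.map (addHom hA (fst _ _) (snd _ _)) (hF.pair (A := A) (B := A) a b)⟩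

/-- Multiplication by `r` is induced by `r : A ⟶ A`. -/
instance (hF : IsPredeformation F) (hA : A.IsComplex) : SMul K (hF.Val hA) :=
  ⟨fun r a => F.map (smulHom hA r (𝟙 A)) a⟩

/-- The zero is the image of the point of `F(0)`. -/
noncomputable instance (hF : IsPredeformation F) (hA : A.IsComplex) : Zero (hF.Val hA) :=
  ⟨F.map (zeroHom (NilpDGA.zero K) A) hF.zero.some.default⟩

noncomputable instance (hF : IsPredeformation F) (hA : A.IsComplex) : Neg (hF.Val hA) :=
  ⟨fun a => (-1 : K) • a⟩

theorem ev_add (hF : IsPredeformation F) (hA : A.IsComplex) (x : F.obj X) (f g : X ⟶ A) :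
    hF.ev hA x f + hF.ev hA x g = hF.ev hA x (addHom hA f g) := by
  have h0 : f ≫ zeroHom A (NilpDGA.zero K) = g ≫ zeroHom A (NilpDGA.zero K) :=
    hom_ext fun _ => rfl
  have h : hF.pair (A := A) (B := A) (F.map f x) (F.map g x) =
      F.map (NilpDGA.lift _ _ f g h0) x := by
    refine (hF.prod_bijective A A).1 (Prod.ext ?_ ?_)
    · refine (hF.pair_spec _ _).1.trans ?_
      change _ = F.map (fst _ _) (F.map (NilpDGA.lift _ _ f g h0) x)
      rw [← Functor.map_comp_apply, lift_fst]
    · refine (hF.pair_spec _ _).2.trans ?_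
      change _ = F.map (snd _ _) (F.map (NilpDGA.lift _ _ f g h0) x)
      rw [← Functor.map_comp_apply, lift_snd]
  change F.map (addHom hA (fst _ _) (snd _ _)) (hF.pair (F.map f x) (F.map g x)) = F.map _ x
  rw [h, ← Functor.map_comp_apply]
  rfl

theorem ev_smul (hF : IsPredeformation F) (hA : A.IsComplex) (x : F.obj X) (r : K) (f : X ⟶ A) :
    r • hF.ev hA x f = hF.ev hA x (smulHom hA r f) := by
  change F.map (smulHom hA r (𝟙 A)) (F.map f x) = F.map _ x
  rw [← Functor.map_comp_apply]
  rfl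

theorem ev_zero (hF : IsPredeformation F) (hA : A.IsComplex) (x : F.obj X) :
    0 = hF.ev hA x (zeroHom X A) := by
  have h : zeroHom X A = zeroHom X (NilpDGA.zero K) ≫ zeroHom (NilpDGA.zero K) A := rfl
  rw [ev, h, Functor.map_comp_apply]
  exact congrArg (F.map _) (hF.zero.some.uniq _).symm

theorem ev_neg (hF : IsPredeformation F) (hA : A.IsComplex) (x : F.obj X) (f : X ⟶ A) :
    -hF.ev hA x f = hF.ev hA x (smulHom hA (-1) f) :=
  hF.ev_smul hA x (-1) f

noncomputable instance (hF : IsPredeformation F) (hA : A.IsComplex) :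
    AddCommGroup (hF.Val hA) where
  add_assoc a b c := by
    obtain ⟨X, x, f, g, h, rfl, rfl, rfl⟩ := hF.exists_ev hA a b c
    simp only [ev_add]
    exact congrArg (hF.ev hA x) (hom_ext fun y => by simp [add_assoc])
  zero_add a := by
    obtain ⟨X, x, f, g, h, rfl, -, -⟩ := hF.exists_ev hA a a a
    rw [hF.ev_zero hA x, ev_add]
    exact congrArg (hF.ev hA x) (hom_ext fun y => by simp)
  add_zero a := by
    obtain ⟨X, x, f, g, h, rfl, -, -⟩ := hF.exists_ev hA a a a
    rw [hF.ev_zero hA x, ev_add]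
    exact congrArg (hF.ev hA x) (hom_ext fun y => by simp)
  nsmul := nsmulRec
  zsmul := zsmulRec
  neg_add_cancel a := by
    obtain ⟨X, x, f, g, h, rfl, -, -⟩ := hF.exists_ev hA a a a
    rw [hF.ev_zero hA x, ev_neg, ev_add]
    exact congrArg (hF.ev hA x) (hom_ext fun y => by simp)
  add_comm a b := by
    obtain ⟨X, x, f, g, h, rfl, rfl, -⟩ := hF.exists_ev hA a b a
    simp only [ev_add]
    exact congrArg (hF.ev hA x) (hom_ext fun y => by simp [add_comm])

noncomputable instance (hF : IsPredeformation F) (hA : A.IsComplex) : Module K (hF.Val hA) where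
  one_smul a := by
    obtain ⟨X, x, f, g, h, rfl, -, -⟩ := hF.exists_ev hA a a a
    rw [ev_smul]
    exact congrArg (hF.ev hA x) (hom_ext fun y => by simp)
  mul_smul r s a := by
    obtain ⟨X, x, f, g, h, rfl, -, -⟩ := hF.exists_ev hA a a a
    simp only [ev_smul]
    exact congrArg (hF.ev hA x) (hom_ext fun y => by simp [mul_smul])
  smul_zero r := by
    obtain ⟨X, x, f, g, h, -, -, -⟩ := hF.exists_ev hA 0 0 0
    simp only [hF.ev_zero hA x, ev_smul]
    exact congrArg (hF.ev hA x) (hom_ext fun y => by simp)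
  smul_add r a b := by
    obtain ⟨X, x, f, g, h, rfl, rfl, -⟩ := hF.exists_ev hA a b a
    simp only [ev_add, ev_smul]
    exact congrArg (hF.ev hA x) (hom_ext fun y => by simp)
  add_smul r s a := by
    obtain ⟨X, x, f, g, h, rfl, -, -⟩ := hF.exists_ev hA a a a
    simp only [ev_add, ev_smul]
    exact congrArg (hF.ev hA x) (hom_ext fun y => by simp [add_smul])
  zero_smul a := by
    obtain ⟨X, x, f, g, h, rfl, -, -⟩ := hF.exists_ev hA a a a
    rw [hF.ev_zero hA x, ev_smul]
    exact congrArg (hF.ev hA x) (hom_ext fun y => by simp)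

/-- The linear map `F(A) → G(A)` induced by a natural transformation, for a complex `A`. -/
noncomputable def valMap (hF : IsPredeformation F) (hG : IsPredeformation G) (θ : F ⟶ G)
    (hA : A.IsComplex) : hF.Val hA →ₗ[K] hG.Val hA where
  toFun a := θ.app A a
  map_add' a b := by
    obtain ⟨X, x, f, g, h, rfl, rfl, -⟩ := hF.exists_ev hA a b a
    rw [ev_add]
    simp only [ev, NatTrans.naturality_apply]
    exact (hG.ev_add hA (θ.app X x) f g).symm
  map_smul' r a := by
    obtain ⟨X, x, f, g, h, rfl, -, -⟩ := hF.exists_ev hA a a a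
    rw [ev_smul]
    simp only [ev, NatTrans.naturality_apply]
    exact (hG.ev_smul hA (θ.app X x) r f).symm

end IsPredeformation

namespace IsDeformation

variable {F G : NilpDGA K ⥤ Type v}

/-- The vector space `T^i F = F(K[i-1])`. -/
noncomputable def T (hF : IsDeformation F) (i : ℤ) : ModuleCat.{v} K :=
  ModuleCat.of K (hF.toIsPredeformation.Val (shift_isComplex (i - 1)))

/-- The tangent space `TF[1]`: the graded vector space whose part of degree `i` is `T^{i+1} F`. -/
noncomputable def tangentSpace (hF : IsDeformation F) : GradedObject ℤ (ModuleCat.{v} K) :=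
  fun i => hF.T (i + 1)

/-- The morphism of graded vector spaces `TF[1] ⟶ TG[1]` induced by `θ : F ⟶ G`. -/
noncomputable def tangentMap (hF : IsDeformation F) (hG : IsDeformation G) (θ : F ⟶ G) :
    hF.tangentSpace ⟶ hG.tangentSpace :=
  fun i => ModuleCat.ofHom (hF.toIsPredeformation.valMap hG.toIsPredeformation θ
    (shift_isComplex (i + 1 - 1)))

end IsDeformation

end ExtDef

/-! Call a surjection `f : A → B` with kernel `I` a small extension if `A I = 0`. Then `(a, a') ↦
(a, a' - a)` identifies `A ×_B A` with `A × I`. Since a predeformation functor `F` preserves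
products, condition (2) says that `F(I)` acts transitively on the fibres of `F(A) → F(B)`. The
kernel `I` is a complex, so if `θ` is bijective on complexes, a lift in `F(A)` can be moved inside
its fibre until its image in `G(A)` is any prescribed element over the same point of `G(B)`
(`exists_adjust`).

Obstructions are handled by the relative cone `A ⊕ I u` with `d u = 1`, which is an acyclic small
extension of `B`. An element of `F(B)` lifts to it by (3), and the obstruction to coming from `A` is
the class in `F(I[1])`, where `I[1]` is the quotient complex by `A`. That class can be tested in
`G`. Filtering a kernel by the powers of the nilpotent algebra gives smoothness (`exists_lift`):
`F(A) → F(B) ×_{G(B)} G(A)` is onto for every surjection `A → B`. The case `B = 0` is surjectivity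
of `θ`.

For injectivity, let `θ x = θ y`. The path object of `A` consists of polynomial forms in `t, dt`,
with coefficients in growing powers of `A` to keep the dimension finite. Smoothness along `path A →
A × A` yields `p ∈ F(path A)` with endpoints `x` and `y` and with `θ p` the constant path at `θ x`.
In characteristic `0` forms can be integrated, so evaluation at `t = 0` is a tower of acyclic small
extensions. It remains to see that `p` is the constant path at `x`, and then `x = y`.

This follows from `ext_of_isAcyclicSmallExtension`: along an acyclic small extension `A → B`, an
element of `F(A)` is determined by its images in `F(B)` and `G(A)`. This is the delicate point, as
neither `F(A) → F(B)` nor `G(A ×_B A) → G(A) × G(A)` need be injective. The difference of two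
candidates lies in `F(I) ≅ G(I)`. Embed `A` in its cone. The quotient `cone A / cone I` is reached
from `0` by acyclic small extensions, and over such a base elements of fibre products are determined
by their projections (`isSeparated_quot_coneIdeal`). So the difference vanishes in `G(cone I)`.
Finally `G(I) → G(cone I)` is injective, because `I` is the fibre over `0` of a map from `cone I`
onto the acyclic complex `I[1]`.

For (b), acyclic small extensions induce bijections, so pairs `a, d a ≠ 0` can be killed in a
complex; what remains has `d = 0` and is a product of lines `K[n]`. Thus bijectivity on the `K[n]`
implies bijectivity on all complexes, and (a) applies. -/

namespace ExtDef

open NilpDGA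

variable {K : Type u} [Field K]

namespace NilpDGA

/-! ### Homogeneous components and signs -/

section Grading

/-- A family of submodules with projections onto its members is an internal grading. -/
theorem isInternal_of_proj {V : Type u} [AddCommGroup V] [Module K V] (gr : ℤ → Submodule K V)
    (p : ℤ → V →ₗ[K] V) (hmem : ∀ i a, p i a ∈ gr i)
    (hp : ∀ i a, a ∈ gr i → ∀ j, p j a = if i = j then a else 0)
    (hsum : ∀ a, ∃ s : Finset ℤ, ∑ i ∈ s, p i a = a) : DirectSum.IsInternal gr := by
  classical
  refine (DirectSum.isInternal_submodule_iff_iSupIndep_and_iSup_eq_top _).2 ⟨?_, ?_⟩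
  · intro i
    refine Submodule.disjoint_def.2 fun x hx hx' => ?_
    have h : (⨆ j, ⨆ (_ : j ≠ i), gr j) ≤ LinearMap.ker (p i) :=
      iSup₂_le fun j hj y hy => by rw [LinearMap.mem_ker, hp j y hy i, if_neg hj]
    have h1 := h hx'
    rwa [LinearMap.mem_ker, hp i x hx i, if_pos rfl] at h1
  · refine eq_top_iff.2 fun x _ => ?_
    obtain ⟨s, hs⟩ := hsum x
    rw [← hs]
    exact Submodule.sum_mem _ fun i _ => Submodule.mem_iSup_of_mem i (hmem i x)

/-- The projection onto the homogeneous part of degree `i`. -/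
noncomputable def proj (A : NilpDGA K) : ℤ → A →ₗ[K] A := A.exists_components.choose

theorem proj_mem (A : NilpDGA K) (i : ℤ) (a : A) : A.proj i a ∈ A.gr i :=
  A.exists_components.choose_spec.1 i a

theorem proj_of_mem (A : NilpDGA K) {i : ℤ} {a : A} (h : a ∈ A.gr i) (j : ℤ) :
    A.proj j a = if i = j then a else 0 :=
  A.exists_components.choose_spec.2.1 i a h j

theorem exists_sum_proj_eq (A : NilpDGA K) (a : A) :
    ∃ s : Finset ℤ, ∀ t : Finset ℤ, s ⊆ t → ∑ i ∈ t, A.proj i a = a :=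
  A.exists_components.choose_spec.2.2 a

/-- Finite dimension allows one finite set of degrees to serve all elements; this is what makes
`sgn` a finite sum of projections. -/
theorem exists_forall_sum_proj_eq (A : NilpDGA K) :
    ∃ s : Finset ℤ, ∀ t : Finset ℤ, s ⊆ t → ∀ a, ∑ i ∈ t, A.proj i a = a := by
  classical
  obtain ⟨T, hT⟩ := (Module.Finite.fg_top : (⊤ : Submodule K A).FG)
  choose s hs using A.exists_sum_proj_eq
  refine ⟨T.biUnion s, fun t ht a => ?_⟩
  have ha : a ∈ Submodule.span K (T : Set A) := hT ▸ Submodule.mem_top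
  induction ha using Submodule.span_induction with
  | mem x hx => exact hs x t ((Finset.subset_biUnion_of_mem s hx).trans ht)
  | zero => simp
  | add x y _ _ hx hy => simp only [map_add, Finset.sum_add_distrib, hx, hy]
  | smul r x _ hx => simp only [map_smul, ← Finset.smul_sum, hx]

theorem gr_induction (A : NilpDGA K) {P : A → Prop} (hom : ∀ i, ∀ a ∈ A.gr i, P a)
    (add : ∀ a b, P a → P b → P (a + b)) (a : A) : P a := by
  obtain ⟨s, hs⟩ := A.exists_sum_proj_eq a
  rw [← hs s subset_rfl]
  exact Finset.sum_induction _ P add (hom 0 0 (zero_mem _)) fun i _ => hom i _ (A.proj_mem i a)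

theorem app_proj {A B : NilpDGA K} (f : A ⟶ B) (i : ℤ) (a : A) :
    app f (A.proj i a) = B.proj i (app f a) :=
  app_component f A.proj_mem A.exists_sum_proj_eq (fun _ _ h => B.proj_of_mem h) i a

/-- The involution `a ↦ (-1)^{|a|} a`. -/
noncomputable def sgn (A : NilpDGA K) : A →ₗ[K] A :=
  ∑ i ∈ A.exists_forall_sum_proj_eq.choose, ((i.negOnePow : ℤ) : K) • A.proj i

theorem sgn_of_mem (A : NilpDGA K) {i : ℤ} {a : A} (h : a ∈ A.gr i) :
    A.sgn a = i.negOnePow • a := by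
  classical
  have h1 := A.exists_forall_sum_proj_eq.choose_spec _ subset_rfl a
  have h2 : ∀ j, ((j.negOnePow : ℤ) : K) • A.proj j a = i.negOnePow • A.proj j a := fun j => by
    rw [A.proj_of_mem h]
    split_ifs with hij
    · rw [hij, Units.smul_def, Int.cast_smul_eq_zsmul]
    · simp
  simp only [sgn, LinearMap.sum_apply, LinearMap.smul_apply, h2]
  rw [← Finset.smul_sum, h1]

theorem sgn_mem (A : NilpDGA K) {i : ℤ} {a : A} (h : a ∈ A.gr i) : A.sgn a ∈ A.gr i := by
  rw [A.sgn_of_mem h]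
  rcases Int.units_eq_one_or i.negOnePow with h1 | h1 <;> simp [h1, h]

@[simp] theorem sgn_sgn (A : NilpDGA K) (a : A) : A.sgn (A.sgn a) = a := by
  induction a using A.gr_induction with
  | hom i a ha =>
    rw [A.sgn_of_mem (A.sgn_mem ha), A.sgn_of_mem ha]
    rcases Int.units_eq_one_or i.negOnePow with h1 | h1 <;> simp [h1]
  | add a b ha hb => simp only [map_add, ha, hb]

theorem sgn_d (A : NilpDGA K) (a : A) : A.sgn (A.d a) = -A.d (A.sgn a) := by
  induction a using A.gr_induction with
  | hom i a ha =>
    rw [A.sgn_of_mem (A.d_mem ha), A.sgn_of_mem ha, Int.negOnePow_succ]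
    rcases Int.units_eq_one_or i.negOnePow with h1 | h1 <;> simp [h1]
  | add a b ha hb => simp only [map_add, ha, hb, neg_add]

theorem sgn_mul (A : NilpDGA K) (a b : A) : A.sgn (a * b) = A.sgn a * A.sgn b := by
  induction a using A.gr_induction with
  | hom i a ha =>
    induction b using A.gr_induction with
    | hom j b hb =>
      rw [A.sgn_of_mem (A.mul_mem ha hb), A.sgn_of_mem ha, A.sgn_of_mem hb, Int.negOnePow_add]
      rcases Int.units_eq_one_or i.negOnePow with h1 | h1 <;>
      rcases Int.units_eq_one_or j.negOnePow with h2 | h2 <;> simp [h1, h2]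
    | add b c hb hc => simp only [map_add, mul_add, hb, hc]
  | add a c ha hc => simp only [map_add, add_mul, ha, hc]

/-- With the sign absorbed in the linear map `sgn`, the Leibniz rule extends from homogeneous
elements by linearity, and later computations need no degrees. -/
theorem d_mul (A : NilpDGA K) (a b : A) : A.d (a * b) = A.d a * b + A.sgn a * A.d b := by
  induction a using A.gr_induction with
  | hom i a ha =>
    rw [A.leibniz b ha, A.sgn_of_mem ha]
    rcases Int.units_eq_one_or i.negOnePow with h1 | h1 <;> simp [h1]
  | add a c ha hc => simp only [map_add, add_mul, ha, hc]; abel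

/-- The involution `sgn` as a morphism of algebras. -/
noncomputable def sgnHom (A : NilpDGA K) : A →ₙₐ[K] A where
  toFun := A.sgn
  map_smul' r x := map_smul A.sgn r x
  map_zero' := map_zero A.sgn
  map_add' := map_add A.sgn
  map_mul' := A.sgn_mul

theorem sgn_mem_power (A : NilpDGA K) {n : ℕ} {a : A} (h : a ∈ power K A n) :
    A.sgn a ∈ power K A n :=
  map_power A.sgnHom n h

theorem map_mem_of_degree (A : NilpDGA K) {V : Type u} [AddCommGroup V] [Module K V]
    (W : Submodule K V) (f : A →ₗ[K] V) (h : ∀ i, ∀ a ∈ A.gr i, f a ∈ W) (a : A) : f a ∈ W :=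
  A.gr_induction h (fun a b ha hb => by rw [map_add]; exact add_mem ha hb) a

end Grading

/-! ### Powers of the algebra -/

section Power

theorem mul_mem_power_succ {A : Type u} [NonUnitalRing A] [Module K A] (x : A) {y : A} {n : ℕ}
    (hy : y ∈ power K A n) : x * y ∈ power K A (n + 1) :=
  Submodule.subset_span ⟨x, y, hy, rfl⟩

theorem mul_mem_power (A : NilpDGA K) {m n : ℕ} {x y : A} (hx : x ∈ power K A m)
    (hy : y ∈ power K A n) : x * y ∈ power K A (m + n + 1) := by
  induction m generalizing x with
  | zero => rw [zero_add]; exact mul_mem_power_succ x hy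
  | succ m ih =>
    refine Submodule.span_induction (p := fun x _ => x * y ∈ power K A (m + 1 + n + 1))
      ?_ ?_ ?_ ?_ hx
    · rintro _ ⟨a, b, hb, rfl⟩
      rw [mul_assoc, show m + 1 + n + 1 = (m + n + 1) + 1 by omega]
      exact mul_mem_power_succ a (ih hb)
    · simp
    · intro a b _ _ ha hb
      rw [add_mul]
      exact add_mem ha hb
    · intro r a _ ha
      rw [smul_mul_assoc]
      exact Submodule.smul_mem _ r ha

end Power

/-! ### Differential graded ideals, subalgebras and quotients -/

section Ideals

/-- A subspace which is homogeneous and stable under the differential and the product. -/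
structure IsDGSub (A : NilpDGA K) (W : Submodule K A) : Prop where
  proj_mem : ∀ i, ∀ x ∈ W, A.proj i x ∈ W
  d_mem : ∀ x ∈ W, A.d x ∈ W
  mul_mem : ∀ x ∈ W, ∀ y ∈ W, x * y ∈ W

/-- Homogeneous ideals stable under the differential. -/
structure IsDGIdeal (A : NilpDGA K) (I : Submodule K A) : Prop where
  proj_mem : ∀ i, ∀ x ∈ I, A.proj i x ∈ I
  d_mem : ∀ x ∈ I, A.d x ∈ I
  mul_left : ∀ a, ∀ x ∈ I, a * x ∈ I
  mul_right : ∀ a, ∀ x ∈ I, x * a ∈ I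

variable {A : NilpDGA K} {I J : Submodule K A}

theorem IsDGIdeal.isDGSub (h : IsDGIdeal A I) : IsDGSub A I :=
  ⟨h.proj_mem, h.d_mem, fun x _ y hy => h.mul_left x y hy⟩

/-- Graded commutativity exchanges homogeneous factors up to sign. Homogeneity of `I` keeps the
components of `x` in `I`, so that the left-hand hypothesis applies to each of them. -/
theorem mul_mem_of_mul_mem (hI : ∀ i, ∀ x ∈ I, A.proj i x ∈ I) (h : ∀ a, ∀ x ∈ I, a * x ∈ J)
    (a x : A) (hx : x ∈ I) : x * a ∈ J := by
  obtain ⟨s, hs⟩ := A.exists_sum_proj_eq x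
  rw [← hs s subset_rfl, Finset.sum_mul]
  refine Submodule.sum_mem _ fun i _ => ?_
  refine A.map_mem_of_degree J (LinearMap.mulLeft K (A.proj i x)) (fun j b hb => ?_) a
  rw [LinearMap.mulLeft_apply, A.graded_comm (A.proj_mem i x) hb]
  have h1 := h b _ (hI i x hx)
  rcases Int.units_eq_one_or (i * j).negOnePow with h2 | h2 <;> simp [h2, h1]

theorem IsDGIdeal.of_left (h1 : ∀ i, ∀ x ∈ I, A.proj i x ∈ I) (h2 : ∀ x ∈ I, A.d x ∈ I)
    (h3 : ∀ a, ∀ x ∈ I, a * x ∈ I) : IsDGIdeal A I :=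
  ⟨h1, h2, h3, mul_mem_of_mul_mem h1 h3⟩

theorem sgn_mem_of_proj_mem (hI : ∀ i, ∀ x ∈ I, A.proj i x ∈ I) {x : A} (hx : x ∈ I) :
    A.sgn x ∈ I := by
  rw [sgn, LinearMap.sum_apply]
  exact Submodule.sum_mem _ fun i _ => Submodule.smul_mem _ _ (hI i x hx)

theorem isDGIdeal_power (A : NilpDGA K) (n : ℕ) : IsDGIdeal A (power K A n) := by
  induction n with
  | zero => exact ⟨fun _ _ _ => trivial, fun _ _ => trivial, fun _ _ _ => trivial,
      fun _ _ _ => trivial⟩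
  | succ n ih =>
    refine IsDGIdeal.of_left ?_ ?_ fun a x hx =>
      power_antitone A (Nat.le_succ _) (mul_mem_power_succ a hx)
    · intro i x hx
      refine (Submodule.span_le (p := (power K A (n + 1)).comap (A.proj i))).2 ?_ hx
      rintro _ ⟨a, b, hb, rfl⟩
      change A.proj i (a * b) ∈ power K A (n + 1)
      obtain ⟨s, hs⟩ := A.exists_sum_proj_eq b
      rw [← hs s subset_rfl, Finset.mul_sum, map_sum]
      refine Submodule.sum_mem _ fun j _ => ?_
      refine A.map_mem_of_degree _ (A.proj i ∘ₗ LinearMap.mulRight K (A.proj j b)) ?_ a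
      intro k c hc
      have h1 := mul_mem_power_succ c (ih.proj_mem j b hb)
      change A.proj i (c * A.proj j b) ∈ _
      rw [A.proj_of_mem (A.mul_mem hc (A.proj_mem j b))]
      split_ifs
      · exact h1
      · exact zero_mem _
    · intro x hx
      refine (Submodule.span_le (p := (power K A (n + 1)).comap A.d)).2 ?_ hx
      rintro _ ⟨a, b, hb, rfl⟩
      change A.d (a * b) ∈ power K A (n + 1)
      rw [A.d_mul]
      exact add_mem (mul_mem_power_succ _ hb) (mul_mem_power_succ _ (ih.d_mem b hb))

theorem IsDGIdeal.inf (hI : IsDGIdeal A I) (hJ : IsDGIdeal A J) : IsDGIdeal A (I ⊓ J) :=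
  ⟨fun i x hx => ⟨hI.proj_mem i x hx.1, hJ.proj_mem i x hx.2⟩,
    fun x hx => ⟨hI.d_mem x hx.1, hJ.d_mem x hx.2⟩,
    fun a x hx => ⟨hI.mul_left a x hx.1, hJ.mul_left a x hx.2⟩,
    fun a x hx => ⟨hI.mul_right a x hx.1, hJ.mul_right a x hx.2⟩⟩

theorem IsDGIdeal.sup (hI : IsDGIdeal A I) (hJ : IsDGIdeal A J) : IsDGIdeal A (I ⊔ J) := by
  have h : ∀ f : A →ₗ[K] A, (∀ x ∈ I, f x ∈ I) → (∀ x ∈ J, f x ∈ J) →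
      ∀ x ∈ I ⊔ J, f x ∈ I ⊔ J := fun f h1 h2 x hx =>
    (sup_le (fun y hy => Submodule.mem_sup_left (h1 y hy))
      (fun y hy => Submodule.mem_sup_right (h2 y hy)) : I ⊔ J ≤ (I ⊔ J).comap f) hx
  exact ⟨fun i => h _ (hI.proj_mem i) (hJ.proj_mem i), h _ hI.d_mem hJ.d_mem,
    fun a => h (LinearMap.mulLeft K a) (hI.mul_left a) (hJ.mul_left a),
    fun a => h (LinearMap.mulRight K a) (hI.mul_right a) (hJ.mul_right a)⟩

theorem isDGIdeal_ker {B : NilpDGA K} (f : A ⟶ B) :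
    IsDGIdeal A (LinearMap.ker (app f : A →ₗ[K] B)) := by
  refine ⟨fun i x hx => ?_, fun x hx => ?_, fun a x hx => ?_, fun a x hx => ?_⟩
  all_goals
    have hx' : app f x = 0 := hx
  · change app f _ = 0
    rw [app_proj, hx', map_zero]
  · change app f _ = 0
    rw [app_d, hx', map_zero]
  · change app f _ = 0
    rw [map_mul, hx', mul_zero]
  · change app f _ = 0
    rw [map_mul, hx', zero_mul]

end Ideals

section Sub

variable {A X : NilpDGA K} {W : Submodule K A}

/-- The subalgebra with a given underlying subspace. -/
def IsDGSub.subalgebra (h : IsDGSub A W) : NonUnitalSubalgebra K A :=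
  { W with mul_mem' := fun hx hy => h.mul_mem _ hx _ hy }

/-- A dg-subalgebra, as an object. -/
def sub (h : IsDGSub A W) : NilpDGA K where
  carrier := h.subalgebra
  finite := inferInstanceAs (FiniteDimensional K W)
  gr i := (A.gr i).comap (NonUnitalSubalgebraClass.subtype h.subalgebra : h.subalgebra →ₗ[K] A)
  isInternal := by
    refine isInternal_of_proj _
      (fun i => (A.proj i).restrict (p := W) (q := W) fun x hx => h.proj_mem i x hx) ?_ ?_ ?_
    · exact fun i a => A.proj_mem i a.1
    · intro i a ha j
      refine Subtype.ext ((A.proj_of_mem ha j).trans ?_)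
      split_ifs <;> rfl
    · intro a
      obtain ⟨s, hs⟩ := A.exists_sum_proj_eq a.1
      refine ⟨s, Subtype.ext ?_⟩
      refine (map_sum W.subtype _ _).trans ?_
      exact hs s subset_rfl
  mul_mem ha hb := A.mul_mem ha hb
  graded_comm ha hb := Subtype.ext (A.graded_comm ha hb)
  d := A.d.restrict (p := W) (q := W) h.d_mem
  d_mem ha := A.d_mem ha
  d_d a := Subtype.ext (A.d_d a.1)
  leibniz b ha := Subtype.ext (A.leibniz b.1 ha)
  nilpotent := by
    obtain ⟨n, hn⟩ := A.nilpotent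
    refine ⟨n, eq_bot_iff.2 fun x hx => ?_⟩
    have h1 := map_power (NonUnitalSubalgebraClass.subtype h.subalgebra) n hx
    rw [hn] at h1
    exact Subtype.ext h1

/-- The inclusion of a dg-subalgebra. -/
def incl (h : IsDGSub A W) : sub h ⟶ A :=
  Hom.mk (NonUnitalSubalgebraClass.subtype h.subalgebra) (fun h => h) (fun _ => rfl)

theorem incl_mem (h : IsDGSub A W) (x : sub h) : app (incl h) x ∈ W := x.2

theorem incl_injective (h : IsDGSub A W) : Function.Injective (app (incl h)) :=
  Subtype.val_injective

/-- A morphism with values in a dg-subalgebra. -/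
def factor (h : IsDGSub A W) (f : X ⟶ A) (hf : ∀ x, app f x ∈ W) : X ⟶ sub h :=
  Hom.mk (NonUnitalAlgHom.codRestrict (app f) h.subalgebra hf) (fun hx => app_gr f hx)
    (fun x => Subtype.ext (app_d f x))

theorem exists_incl_eq (h : IsDGSub A W) {a : A} (ha : a ∈ W) :
    ∃ x : sub h, app (incl h) x = a := ⟨⟨a, ha⟩, rfl⟩

theorem sub_isComplex (h : IsDGSub A W) (h0 : ∀ x ∈ W, ∀ y ∈ W, x * y = 0) :
    (sub h).IsComplex :=
  fun x y => Subtype.ext (h0 x.1 x.2 y.1 y.2)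

end Sub

section Quot

variable {A X : NilpDGA K} {I J : Submodule K A}

/-- The vector space underlying the quotient by a dg-ideal. -/
def QuotCarrier (_ : IsDGIdeal A I) : Type u := A ⧸ I

instance (h : IsDGIdeal A I) : AddCommGroup (QuotCarrier h) :=
  inferInstanceAs (AddCommGroup (A ⧸ I))

instance (h : IsDGIdeal A I) : Module K (QuotCarrier h) := inferInstanceAs (Module K (A ⧸ I))

instance (h : IsDGIdeal A I) : FiniteDimensional K (QuotCarrier h) :=
  inferInstanceAs (FiniteDimensional K (A ⧸ I))

/-- The projection onto the quotient, as a linear map. -/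
def quotLin (h : IsDGIdeal A I) : A →ₗ[K] QuotCarrier h := I.mkQ

theorem quotLin_surjective (h : IsDGIdeal A I) : Function.Surjective (quotLin h) :=
  Submodule.mkQ_surjective I

instance (h : IsDGIdeal A I) : Mul (QuotCarrier h) :=
  ⟨Quotient.map₂ (· * ·) fun a a' ha b b' hb => by
    replace ha := (Submodule.quotientRel_def I).1 ha
    replace hb := (Submodule.quotientRel_def I).1 hb
    refine (Submodule.quotientRel_def I).2 ?_
    have h1 : a * b - a' * b' = (a - a') * b + a' * (b - b') := by
      rw [sub_mul, mul_sub]; abel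
    rw [h1]
    exact add_mem (h.mul_right _ _ ha) (h.mul_left _ _ hb)⟩

theorem quotLin_mul (h : IsDGIdeal A I) (a b : A) :
    quotLin h (a * b) = quotLin h a * quotLin h b := rfl

instance (h : IsDGIdeal A I) : NonUnitalRing (QuotCarrier h) where
  left_distrib := by
    simp only [(quotLin_surjective h).forall, ← map_add, ← quotLin_mul, mul_add, implies_true]
  right_distrib := by
    simp only [(quotLin_surjective h).forall, ← map_add, ← quotLin_mul, add_mul, implies_true]
  zero_mul := by
    simp only [(quotLin_surjective h).forall, ← map_zero (quotLin h), ← quotLin_mul, zero_mul,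
      implies_true]
  mul_zero := by
    simp only [(quotLin_surjective h).forall, ← map_zero (quotLin h), ← quotLin_mul, mul_zero,
      implies_true]
  mul_assoc := by
    simp only [(quotLin_surjective h).forall, ← quotLin_mul, mul_assoc, implies_true]

/-- The quotient by a dg-ideal. -/
def quot (h : IsDGIdeal A I) : NilpDGA K where
  carrier := QuotCarrier h
  scalarTower := ⟨fun r => by
    simp only [(quotLin_surjective h).forall, smul_eq_mul, ← map_smul, ← quotLin_mul,
      smul_mul_assoc, implies_true]⟩
  smulComm := ⟨fun r => by
    simp only [(quotLin_surjective h).forall, smul_eq_mul, ← map_smul, ← quotLin_mul,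
      mul_smul_comm, implies_true]⟩
  gr := fun i => (A.gr i).map (quotLin h)
  isInternal := by
    refine isInternal_of_proj _ (fun i => I.mapQ I (A.proj i) fun x hx => h.proj_mem i x hx)
      ?_ ?_ ?_
    · rintro i ⟨a⟩
      exact ⟨_, A.proj_mem i a, rfl⟩
    · rintro i _ ⟨a, ha, rfl⟩ j
      refine (congrArg (quotLin h) (A.proj_of_mem ha j)).trans ?_
      split_ifs <;> simp
    · rintro ⟨a⟩
      obtain ⟨s, hs⟩ := A.exists_sum_proj_eq a
      refine ⟨s, Eq.trans ?_ (congrArg (quotLin h) (hs s subset_rfl))⟩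
      rw [map_sum]
      rfl
  mul_mem := by
    rintro i j _ _ ⟨a, ha, rfl⟩ ⟨b, hb, rfl⟩
    exact ⟨_, A.mul_mem ha hb, rfl⟩
  graded_comm := by
    rintro i j _ _ ⟨a, ha, rfl⟩ ⟨b, hb, rfl⟩
    refine (congrArg (quotLin h) (A.graded_comm ha hb)).trans ?_
    rw [Units.smul_def, Units.smul_def, map_zsmul]
    rfl
  d := I.mapQ I A.d fun x hx => h.d_mem x hx
  d_mem := by
    rintro i _ ⟨a, ha, rfl⟩
    exact ⟨_, A.d_mem ha, rfl⟩
  d_d := by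
    rintro ⟨a⟩
    exact congrArg (quotLin h) (A.d_d a)
  leibniz := by
    rintro i _ ⟨b⟩ ⟨a, ha, rfl⟩
    refine (congrArg (quotLin h) (A.leibniz b ha)).trans ?_
    rw [Units.smul_def, Units.smul_def, map_add, map_zsmul]
    rfl
  nilpotent := by
    obtain ⟨n, hn⟩ := A.nilpotent
    refine ⟨n, ?_⟩
    have h1 : ∀ m, power K (QuotCarrier h) m ≤ (power K A m).map (quotLin h) := by
      intro m
      induction m with
      | zero => rintro ⟨a⟩ -; exact ⟨a, trivial, rfl⟩
      | succ m ih =>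
        refine Submodule.span_le.2 ?_
        rintro _ ⟨⟨x⟩, y, hy, rfl⟩
        obtain ⟨z, hz, rfl⟩ := ih hy
        exact ⟨x * z, mul_mem_power_succ x hz, rfl⟩
    refine eq_bot_iff.2 ((h1 n).trans ?_)
    rw [hn, Submodule.map_bot]

/-- The projection onto the quotient. -/
def quotMk (h : IsDGIdeal A I) : A ⟶ quot h :=
  Hom.mk (B := quot h)
    { toFun := quotLin h
      map_smul' := fun _ _ => rfl
      map_zero' := rfl
      map_add' := fun _ _ => rfl
      map_mul' := fun _ _ => rfl }
    (fun hx => ⟨_, hx, rfl⟩) (fun _ => rfl)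

theorem quotMk_surjective (h : IsDGIdeal A I) : Function.Surjective (app (quotMk h)) :=
  Submodule.mkQ_surjective I

theorem quotMk_eq_zero (h : IsDGIdeal A I) {a : A} : app (quotMk h) a = 0 ↔ a ∈ I :=
  Submodule.Quotient.mk_eq_zero I

/-- The morphism induced on the quotient. -/
def desc (h : IsDGIdeal A I) (f : A ⟶ X) (hf : ∀ x ∈ I, app f x = 0) : quot h ⟶ X :=
  Hom.mk (A := quot h)
    { toFun := I.liftQ (app f : A →ₗ[K] X) hf
      map_smul' := fun r x => map_smul _ r x
      map_zero' := map_zero _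
      map_add' := map_add _
      map_mul' := by
        rintro ⟨a⟩ ⟨b⟩
        exact map_mul (app f) a b }
    (by
      rintro i _ ⟨a, ha, rfl⟩
      exact app_gr f ha)
    (by
      rintro ⟨a⟩
      exact app_d f a)

theorem quotMk_desc (h : IsDGIdeal A I) (f : A ⟶ X) (hf : ∀ x ∈ I, app f x = 0) :
    quotMk h ≫ desc h f hf = f := rfl

/-- The projection `A / I ⟶ A / J` for `I ≤ J`. -/
def quotMap (hI : IsDGIdeal A I) (hJ : IsDGIdeal A J) (hle : I ≤ J) : quot hI ⟶ quot hJ :=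
  desc hI (quotMk hJ) fun _ hx => (quotMk_eq_zero hJ).2 (hle hx)

/-- The hypotheses express `A J ⊆ I` and acyclicity of `J / I` inside `A`. The towers for the cone
and for the path object are both produced by this criterion. -/
theorem isAcyclicSmallExtension_quotMap (hI : IsDGIdeal A I) (hJ : IsDGIdeal A J) (hle : I ≤ J)
    (hmul : ∀ a, ∀ x ∈ J, a * x ∈ I)
    (hd : ∀ x ∈ J, A.d x ∈ I → ∃ y ∈ J, x - A.d y ∈ I) :
    IsAcyclicSmallExtension (quotMap hI hJ hle) where
  surjective b := by
    obtain ⟨a, rfl⟩ := quotMk_surjective hJ b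
    exact ⟨app (quotMk hI) a, rfl⟩
  mul_ker a x hx := by
    obtain ⟨a, rfl⟩ := quotMk_surjective hI a
    obtain ⟨x, rfl⟩ := quotMk_surjective hI x
    rw [← map_mul, quotMk_eq_zero]
    exact hmul a x ((quotMk_eq_zero hJ).1 hx)
  acyclic_ker x hx hdx := by
    obtain ⟨x, rfl⟩ := quotMk_surjective hI x
    rw [← app_d, quotMk_eq_zero] at hdx
    obtain ⟨y, hy, hxy⟩ := hd x ((quotMk_eq_zero hJ).1 hx) hdx
    refine ⟨app (quotMk hI) y, (quotMk_eq_zero hJ).2 hy, ?_⟩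
    rw [← app_d, ← sub_eq_zero, ← map_sub, quotMk_eq_zero, ← neg_mem_iff, neg_sub]
    exact hxy

/-- A bijective morphism is an acyclic small extension. -/
theorem isAcyclicSmallExtension_of_bijective {B : NilpDGA K} (f : A ⟶ B)
    (h : Function.Bijective (app f)) : IsAcyclicSmallExtension f := by
  have h0 : ∀ x, app f x = 0 → x = 0 := fun x hx => h.1 (hx.trans (map_zero _).symm)
  refine ⟨h.2, fun a x hx => by rw [h0 x hx, mul_zero], fun x hx _ => ⟨0, map_zero _, ?_⟩⟩
  rw [h0 x hx, map_zero]

end Quot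

/-- Meant for coefficient maps, which shift degrees: the coefficient of `u` has degree `1`, that of
`t ^ n dt` has degree `-1`. -/
theorem map_proj {A B : NilpDGA K} (f : A →ₗ[K] B) (c : ℤ)
    (h : ∀ i, ∀ a ∈ A.gr i, f a ∈ B.gr (i + c)) (i : ℤ) (a : A) :
    f (A.proj i a) = B.proj (i + c) (f a) := by
  induction a using A.gr_induction with
  | hom j a ha =>
    rw [A.proj_of_mem ha, B.proj_of_mem (h j a ha)]
    by_cases hij : j = i
    · simp [hij]
    · simp [hij]
  | add a b ha hb => simp only [map_add, ha, hb]

/-! ### Adjoining an odd variable of square zero -/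

section OddExtension

/-- Signs see only the parity of `k`, so one construction serves both `u` of degree `-1` and `dt` of
degree `1`. -/
theorem negOnePow_mul_odd {k : ℤ} (hk : Odd k) (i : ℤ) :
    (i * k).negOnePow = i.negOnePow := by
  rw [Int.negOnePow_eq_iff, ← mul_sub_one]
  exact (hk.sub_odd odd_one).mul_left i

variable (A : NilpDGA K)

/-- The vector space `A ⊕ A ε`, with `ε` of odd degree. -/
def OddCarrier : Type u := A × A

instance : AddCommGroup (OddCarrier A) := inferInstanceAs (AddCommGroup (A × A))

instance : Module K (OddCarrier A) := inferInstanceAs (Module K (A × A))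

instance : FiniteDimensional K (OddCarrier A) := inferInstanceAs (FiniteDimensional K (A × A))

variable {A} in
/-- The element `a + b ε`. -/
def odd (a b : A) : OddCarrier A := (a, b)

/-- The coefficient `a` of `a + b ε`. -/
def oddFst : OddCarrier A →ₗ[K] A := LinearMap.fst K A A

/-- The coefficient `b` of `a + b ε`. -/
def oddSnd : OddCarrier A →ₗ[K] A := LinearMap.snd K A A

variable {A}

@[simp] theorem oddFst_odd (a b : A) : oddFst A (odd a b) = a := rfl

@[simp] theorem oddSnd_odd (a b : A) : oddSnd A (odd a b) = b := rfl

theorem odd_ext {x y : OddCarrier A} (h1 : oddFst A x = oddFst A y)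
    (h2 : oddSnd A x = oddSnd A y) : x = y := Prod.ext h1 h2

noncomputable instance : Mul (OddCarrier A) :=
  ⟨fun x y => odd (oddFst A x * oddFst A y)
    (oddFst A x * oddSnd A y + oddSnd A x * A.sgn (oddFst A y))⟩

@[simp] theorem oddFst_mul (x y : OddCarrier A) : oddFst A (x * y) = oddFst A x * oddFst A y := rfl

@[simp] theorem oddSnd_mul (x y : OddCarrier A) :
    oddSnd A (x * y) = oddFst A x * oddSnd A y + oddSnd A x * A.sgn (oddFst A y) := rfl

noncomputable instance : NonUnitalRing (OddCarrier A) where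
  left_distrib x y z := odd_ext (by simp [mul_add]) (by simp [mul_add]; abel)
  right_distrib x y z := odd_ext (by simp [add_mul]) (by simp [add_mul]; abel)
  zero_mul x := odd_ext (by simp) (by simp)
  mul_zero x := odd_ext (by simp) (by simp)
  mul_assoc x y z := odd_ext (by simp [mul_assoc])
    (by simp [add_mul, mul_add, mul_assoc, A.sgn_mul, add_assoc])

variable (A) in
/-- The involution `a + b ε ↦ sgn a - sgn b ε`. -/
noncomputable def oddSgn : OddCarrier A →ₗ[K] OddCarrier A :=
  LinearMap.prodMap A.sgn (-A.sgn)

@[simp] theorem oddFst_oddSgn (x : OddCarrier A) : oddFst A (oddSgn A x) = A.sgn (oddFst A x) := rfl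

@[simp] theorem oddSnd_oddSgn (x : OddCarrier A) :
    oddSnd A (oddSgn A x) = -A.sgn (oddSnd A x) := rfl

variable (A) in
/-- The homogeneous parts of `A ⊕ A ε`, with `ε` of degree `k`. -/
noncomputable def oddGr (k i : ℤ) : Submodule K (OddCarrier A) :=
  (A.gr i).comap (oddFst A) ⊓ (A.gr (i - k)).comap (oddSnd A)

variable (A) in
/-- The algebra `A ⊕ A ε`, where `ε` has odd degree `k` and square zero, with a given
differential. -/
noncomputable def oddExt (k : ℤ) (hk : Odd k) (D : OddCarrier A →ₗ[K] OddCarrier A)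
    (D_mem : ∀ {i x}, x ∈ oddGr A k i → D x ∈ oddGr A k (i + 1)) (D_D : ∀ x, D (D x) = 0)
    (D_mul : ∀ x y, D (x * y) = D x * y + oddSgn A x * D y) : NilpDGA K where
  carrier := OddCarrier A
  scalarTower := ⟨fun r x y => odd_ext (by simp [smul_mul_assoc]) (by simp [smul_mul_assoc])⟩
  smulComm := ⟨fun r x y => odd_ext (by simp [mul_smul_comm]) (by simp [mul_smul_comm])⟩
  gr := oddGr A k
  isInternal := by
    classical
    refine isInternal_of_proj _ (fun i => LinearMap.prodMap (A.proj i) (A.proj (i - k))) ?_ ?_ ?_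
    · exact fun i x => ⟨A.proj_mem i _, A.proj_mem (i - k) _⟩
    · intro i x hx j
      have h1 := A.proj_of_mem hx.1 j
      have h2 := A.proj_of_mem hx.2 (j - k)
      refine odd_ext (h1.trans ?_) (h2.trans ?_)
      · split_ifs <;> rfl
      · simp only [sub_left_inj]
        split_ifs <;> rfl
    · intro x
      obtain ⟨s, hs⟩ := A.exists_forall_sum_proj_eq
      -- The component of degree `i` of `a + b ε` involves `b` in degree `i - k`, so the degrees of
      -- `b` enter shifted by `k`.
      refine ⟨s ∪ s.image (· + k), odd_ext ?_ ?_⟩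
      · rw [map_sum]
        exact hs _ Finset.subset_union_left _
      · rw [map_sum]
        refine Eq.trans ?_ (hs ((s ∪ s.image (· + k)).image (· - k)) (fun i hi => ?_) (oddSnd A x))
        · rw [Finset.sum_image fun a _ b _ h => sub_left_injective h]
          rfl
        · exact Finset.mem_image.2 ⟨i + k, Finset.mem_union_right _
            (Finset.mem_image_of_mem _ hi), by simp⟩
  mul_mem {i j x y} hx hy := by
    refine ⟨A.mul_mem hx.1 hy.1, add_mem (S := Submodule K A) ?_ ?_⟩
    · have h := A.mul_mem hx.1 hy.2
      rwa [← add_sub_assoc] at h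
    · have h := A.mul_mem hx.2 (A.sgn_mem hy.1)
      rwa [sub_add_eq_add_sub] at h
  graded_comm {i j x y} hx hy := by
    have hk' := Int.negOnePow_odd k hk
    refine odd_ext ?_ ?_
    · refine (A.graded_comm hx.1 hy.1).trans ?_
      rw [Units.smul_def, Units.smul_def, map_zsmul]
      rfl
    · rw [Units.smul_def, map_zsmul, ← Units.smul_def, oddSnd_mul, oddSnd_mul,
        A.graded_comm hx.1 hy.2, A.sgn_of_mem hx.1, A.sgn_of_mem hy.1]
      have h1 : oddSnd A x * (j.negOnePow • oddFst A y) =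
          j.negOnePow • (oddSnd A x * oddFst A y) := by
        rcases Int.units_eq_one_or j.negOnePow with h | h <;> simp [h]
      have h2 : oddSnd A y * (i.negOnePow • oddFst A x) =
          i.negOnePow • (oddSnd A y * oddFst A x) := by
        rcases Int.units_eq_one_or i.negOnePow with h | h <;> simp [h]
      rw [h1, h2, A.graded_comm hx.2 hy.1, smul_add, smul_smul, smul_smul]
      have h3 : (i * (j - k)).negOnePow = (i * j).negOnePow * i.negOnePow := by
        rw [mul_sub, Int.negOnePow_sub, negOnePow_mul_odd hk]
      have h4 : j.negOnePow * ((i - k) * j).negOnePow = (i * j).negOnePow := by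
        rw [sub_mul, Int.negOnePow_sub, mul_comm k j, negOnePow_mul_odd hk, mul_comm,
          mul_assoc, Int.units_mul_self, mul_one]
      rw [h3, h4, add_comm]
  d := D
  d_mem := D_mem
  d_d := D_D
  leibniz {i x} y hx := by
    have h : oddSgn A x = i.negOnePow • x := by
      refine odd_ext ?_ ?_
      · rw [Units.smul_def, map_zsmul, ← Units.smul_def]
        exact A.sgn_of_mem hx.1
      · rw [Units.smul_def, map_zsmul, ← Units.smul_def, oddSnd_oddSgn, A.sgn_of_mem hx.2,
          Int.negOnePow_sub, Int.negOnePow_odd k hk]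
        rcases Int.units_eq_one_or i.negOnePow with h | h <;> simp [h]
    rw [D_mul, h]
    rcases Int.units_eq_one_or i.negOnePow with h | h <;> simp [h]
  nilpotent := by
    obtain ⟨n, hn⟩ := A.nilpotent
    refine ⟨n, ?_⟩
    have h1 : ∀ m, power K (OddCarrier A) m ≤
        (power K A m).comap (oddFst A) ⊓ (power K A m).comap (oddSnd A) := by
      intro m
      induction m with
      | zero => exact fun _ _ => ⟨trivial, trivial⟩
      | succ m ih =>
        refine Submodule.span_le.2 ?_
        rintro _ ⟨x, y, hy, rfl⟩
        obtain ⟨h1, h2⟩ := ih hy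
        exact ⟨mul_mem_power_succ _ h1, add_mem (mul_mem_power_succ _ h2)
          (mul_mem_power_succ _ (A.sgn_mem_power h1))⟩
    refine eq_bot_iff.2 fun x hx => ?_
    have h2 := h1 n hx
    rw [hn] at h2
    exact odd_ext h2.1 h2.2

end OddExtension

/-! ### The cone and its subalgebras -/

section Cone

variable (A : NilpDGA K)

/-- The differential of the cone: `d(a + b u) = (d a + sgn b) + d b u`. -/
noncomputable def coneD : OddCarrier A →ₗ[K] OddCarrier A :=
  LinearMap.prod (A.d ∘ₗ oddFst A + A.sgn ∘ₗ oddSnd A) (A.d ∘ₗ oddSnd A)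

variable {A} in
@[simp] theorem oddFst_coneD (x : OddCarrier A) :
    oddFst A (coneD A x) = A.d (oddFst A x) + A.sgn (oddSnd A x) := rfl

variable {A} in
@[simp] theorem oddSnd_coneD (x : OddCarrier A) : oddSnd A (coneD A x) = A.d (oddSnd A x) := rfl

/-- The cone `A ⊗ K[u]`, with `u` of degree `-1` and `d u = 1`. -/
noncomputable def cone : NilpDGA K :=
  oddExt A (-1) (by decide) (coneD A)
    (fun {i x} hx => by
      have h : A.sgn (oddSnd A x) ∈ A.gr (i - -1) := A.sgn_mem hx.2
      have h' : A.d (oddSnd A x) ∈ A.gr (i - -1 + 1) := A.d_mem hx.2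
      refine ⟨add_mem (A.d_mem hx.1) ?_, ?_⟩
      · rwa [sub_neg_eq_add] at h
      · change A.d (oddSnd A x) ∈ A.gr _
        rwa [sub_add_eq_add_sub] at h')
    (fun x => odd_ext (by simp [A.d_d, A.sgn_d]) (by simp [A.d_d]))
    (fun x y => odd_ext
      (by simp [A.d_mul, A.sgn_mul]; noncomm_ring)
      (by simp [A.d_mul, A.sgn_d]; noncomm_ring))

/-- The inclusion of `A` in its cone. -/
noncomputable def toCone : A ⟶ cone A :=
  Hom.mk (B := cone A)
    { toFun := fun a => odd a 0
      map_smul' := fun r a => odd_ext rfl (smul_zero r).symm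
      map_zero' := rfl
      map_add' := fun a b => odd_ext rfl (add_zero 0).symm
      map_mul' := fun a b => (odd_ext rfl (by simp) : odd (a * b) (0 : A) = odd a 0 * odd b 0) }
    (fun ha => ⟨ha, Submodule.zero_mem (A.gr _)⟩)
    (fun a => odd_ext (by change A.d a = oddFst A (coneD A (odd a 0)); simp)
      (by change 0 = oddSnd A (coneD A (odd a 0)); simp))

/-- The coefficient `a` of `a + b u`. -/
noncomputable def coneFst : cone A →ₗ[K] A := oddFst A

/-- The coefficient `b` of `a + b u`. -/
noncomputable def coneSnd : cone A →ₗ[K] A := oddSnd A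

variable {A}

/-- The element `a + b u` of the cone. -/
noncomputable def coneElt (a b : A) : cone A := odd a b

theorem cone_ext {x y : cone A} (h1 : coneFst A x = coneFst A y) (h2 : coneSnd A x = coneSnd A y) :
    x = y := odd_ext h1 h2

@[simp] theorem coneFst_coneElt (a b : A) : coneFst A (coneElt a b) = a := rfl

@[simp] theorem coneSnd_coneElt (a b : A) : coneSnd A (coneElt a b) = b := rfl

@[simp] theorem coneFst_mul (x y : cone A) : coneFst A (x * y) = coneFst A x * coneFst A y := rfl

@[simp] theorem coneSnd_mul (x y : cone A) :
    coneSnd A (x * y) = coneFst A x * coneSnd A y + coneSnd A x * A.sgn (coneFst A y) := rfl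

@[simp] theorem coneFst_d (x : cone A) :
    coneFst A ((cone A).d x) = A.d (coneFst A x) + A.sgn (coneSnd A x) := rfl

@[simp] theorem coneSnd_d (x : cone A) : coneSnd A ((cone A).d x) = A.d (coneSnd A x) := rfl

theorem coneFst_mem {i : ℤ} {x : cone A} (h : x ∈ (cone A).gr i) : coneFst A x ∈ A.gr i := h.1

theorem coneSnd_mem {i : ℤ} {x : cone A} (h : x ∈ (cone A).gr i) : coneSnd A x ∈ A.gr (i + 1) :=
  (sub_neg_eq_add i 1) ▸ h.2

theorem coneFst_proj (i : ℤ) (x : cone A) :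
    coneFst A ((cone A).proj i x) = A.proj i (coneFst A x) := by
  have h := map_proj (coneFst A) 0 (fun i a ha => by rw [add_zero]; exact coneFst_mem ha) i x
  rwa [add_zero] at h

theorem coneSnd_proj (i : ℤ) (x : cone A) :
    coneSnd A ((cone A).proj i x) = A.proj (i + 1) (coneSnd A x) :=
  map_proj (coneSnd A) 1 (fun _ _ ha => coneSnd_mem ha) i x

/-- The subspace `J ⊗ K[u]` of the cone. -/
noncomputable def coneIdeal (J : Submodule K A) : Submodule K (cone A) :=
  J.comap (coneFst A) ⊓ J.comap (coneSnd A)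

variable {I J : Submodule K A}

theorem mul_mem_coneIdeal (hJ : IsDGIdeal A J) (h : ∀ a, ∀ x ∈ J, a * x ∈ I) (a : cone A)
    {x : cone A} (hx : x ∈ coneIdeal J) : a * x ∈ coneIdeal I :=
  ⟨h _ _ hx.1, add_mem (S := Submodule K A) (h _ _ hx.2)
    (h _ _ (sgn_mem_of_proj_mem hJ.proj_mem hx.1))⟩

theorem isDGIdeal_coneIdeal (hJ : IsDGIdeal A J) : IsDGIdeal (cone A) (coneIdeal J) := by
  refine IsDGIdeal.of_left (fun i x hx => ⟨?_, ?_⟩) (fun x hx => ⟨?_, ?_⟩)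
    fun a x hx => mul_mem_coneIdeal hJ hJ.mul_left a hx
  · change coneFst A _ ∈ J
    rw [coneFst_proj]
    exact hJ.proj_mem _ _ hx.1
  · change coneSnd A _ ∈ J
    rw [coneSnd_proj]
    exact hJ.proj_mem _ _ hx.2
  · exact add_mem (S := Submodule K A) (hJ.d_mem _ hx.1) (sgn_mem_of_proj_mem hJ.proj_mem hx.2)
  · exact hJ.d_mem _ hx.2

/-- The contraction `a + b u ↦ sgn a u` shows that the cone of any quotient `J / I` is acyclic: if
`d a + sgn b` lies in `I`, applying `sgn` gives `b ≡ d (sgn a)` modulo `I`. -/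
theorem coneIdeal_acyclic (hI : IsDGIdeal A I) (hJ : IsDGIdeal A J) {x : cone A}
    (hx : x ∈ coneIdeal J) (hdx : (cone A).d x ∈ coneIdeal I) :
    ∃ y ∈ coneIdeal J, x - (cone A).d y ∈ coneIdeal I := by
  refine ⟨coneElt 0 (A.sgn (coneFst A x)),
    ⟨zero_mem J, sgn_mem_of_proj_mem hJ.proj_mem hx.1⟩, ?_, ?_⟩
  · change coneFst A (x - (cone A).d _) ∈ I
    simp
  · change coneSnd A (x - (cone A).d _) ∈ I
    have h := sgn_mem_of_proj_mem hI.proj_mem hdx.1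
    rw [coneFst_d, map_add, sgn_sgn, sgn_d] at h
    rw [map_sub, coneSnd_d, coneSnd_coneElt]
    convert h using 1
    abel

theorem isDGSub_comap_coneSnd (hI : IsDGIdeal A I) : IsDGSub (cone A) (I.comap (coneSnd A)) := by
  refine ⟨fun i x hx => ?_, fun x hx => hI.d_mem _ hx, fun x hx y hy =>
    add_mem (S := Submodule K A) (hI.mul_left _ _ hy) (hI.mul_right _ _ hx)⟩
  change coneSnd A _ ∈ I
  rw [coneSnd_proj]
  exact hI.proj_mem _ _ hx

section Base

variable {W : Submodule K (cone A)} (hW : IsDGSub (cone A) W)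
  (h0 : ∀ x ∈ W, ∀ y ∈ W, coneSnd A (x * y) = 0)

/-- The coefficient of `u`, for elements of a subalgebra of the cone. -/
noncomputable def subSnd : sub hW →ₗ[K] A := coneSnd A ∘ₗ (app (incl hW) : sub hW →ₗ[K] cone A)

theorem subSnd_apply (x : sub hW) : subSnd hW x = coneSnd A (app (incl hW) x) := rfl

include h0 in
-- By `h0`, products in `W` have no `u`-coefficient. Hence the elements of `W` without `u` form an
-- ideal containing all products, and the quotient is a complex.
theorem isDGIdeal_ker_subSnd : IsDGIdeal (sub hW) (LinearMap.ker (subSnd hW)) := by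
  refine IsDGIdeal.of_left (fun i x hx => ?_) (fun x hx => ?_) fun a x hx => ?_
  · rw [LinearMap.mem_ker, subSnd_apply] at *
    rw [app_proj, coneSnd_proj, hx, map_zero]
  · rw [LinearMap.mem_ker, subSnd_apply] at *
    rw [app_d, coneSnd_d, hx, map_zero]
  · rw [LinearMap.mem_ker, subSnd_apply, map_mul]
    exact h0 _ (incl_mem hW a) _ (incl_mem hW x)

theorem quot_ker_subSnd_isComplex :
    (quot (isDGIdeal_ker_subSnd hW h0)).IsComplex := by
  intro x y
  obtain ⟨x, rfl⟩ := quotMk_surjective _ x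
  obtain ⟨y, rfl⟩ := quotMk_surjective _ y
  rw [← map_mul, quotMk_eq_zero, LinearMap.mem_ker, subSnd_apply, map_mul]
  exact h0 _ (incl_mem hW x) _ (incl_mem hW y)

theorem subSnd_d (x : sub hW) : subSnd hW ((sub hW).d x) = A.d (subSnd hW x) := rfl

theorem quot_ker_subSnd_isAcyclic
    (h : ∀ x ∈ W, A.d (coneSnd A x) = 0 → ∃ w ∈ W, A.d (coneSnd A w) = coneSnd A x) :
    (quot (isDGIdeal_ker_subSnd hW h0)).IsAcyclic := by
  intro x hx
  obtain ⟨x, rfl⟩ := quotMk_surjective _ x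
  rw [← app_d, quotMk_eq_zero, LinearMap.mem_ker, subSnd_d] at hx
  obtain ⟨w, hw, hwx⟩ := h _ (incl_mem hW x) hx
  obtain ⟨w, rfl⟩ := exists_incl_eq hW hw
  refine ⟨app (quotMk _) w, ?_⟩
  rw [← app_d, ← sub_eq_zero, ← map_sub, quotMk_eq_zero, LinearMap.mem_ker, map_sub, subSnd_d,
    sub_eq_zero]
  exact hwx

/-- The fibre of a subalgebra of the cone over `0` in the quotient by the elements
of the base. -/
noncomputable abbrev baseFiber : NilpDGA K :=
  fiberProd (quotMk (isDGIdeal_ker_subSnd hW h0)) (zeroHom (zero K) _)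

theorem subSnd_fst (x : baseFiber hW h0) :
    coneSnd A (app (incl hW) (app (fst _ _) x)) = 0 := by
  have h := congrArg (fun k => app k x) (fiber_condition (quotMk (isDGIdeal_ker_subSnd hW h0))
    (zeroHom (zero K) _))
  exact (quotMk_eq_zero (isDGIdeal_ker_subSnd hW h0)).1 h

/-- The projection to the base. -/
noncomputable def baseFiberHom : baseFiber hW h0 ⟶ A :=
  Hom.mk
    { toFun := fun x => coneFst A (app (incl hW) (app (fst _ _) x))
      map_smul' := fun r x => by simp only [map_smul]; rfl
      map_zero' := by simp only [map_zero]
      map_add' := fun x y => by simp only [map_add]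
      map_mul' := fun x y => by simp only [map_mul, coneFst_mul] }
    (fun hx => coneFst_mem (app_gr (incl hW) (app_gr (fst _ _) hx)))
    (fun x => by
      change coneFst A (app (incl hW) (app (fst _ _) _)) = A.d (coneFst A _)
      rw [app_d, app_d, coneFst_d, subSnd_fst, map_zero, add_zero])

/-- A morphism to the fibre, given by a morphism with values in the base. -/
noncomputable def toBaseFiber {X : NilpDGA K} (g : X ⟶ sub hW)
    (hg : ∀ x, coneSnd A (app (incl hW) (app g x)) = 0) : X ⟶ baseFiber hW h0 :=
  lift _ _ g (zeroHom _ _) (hom_ext fun x => (quotMk_eq_zero (isDGIdeal_ker_subSnd hW h0)).2 (hg x))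

end Base

end Cone

/-! ### Small extensions and differences of liftings -/

section Small

variable {A B X : NilpDGA K}

/-- Small extensions: surjective morphisms whose kernel is annihilated by the algebra. -/
structure IsSmallExtension (f : A ⟶ B) : Prop where
  surjective : Function.Surjective (app f)
  mul_ker : ∀ a x : A, app f x = 0 → a * x = 0

theorem IsAcyclicSmallExtension.isSmallExtension {f : A ⟶ B} (h : IsAcyclicSmallExtension f) :
    IsSmallExtension f := ⟨h.surjective, h.mul_ker⟩

theorem IsSmallExtension.ker_mul {f : A ⟶ B} (h : IsSmallExtension f) (a x : A)
    (hx : app f x = 0) : x * a = 0 :=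
  mul_mem_of_mul_mem (J := ⊥) (isDGIdeal_ker f).proj_mem (fun b y hy => h.mul_ker b y hy) a x hx

/-- The kernel of a morphism. -/
def kerObj (f : A ⟶ B) : NilpDGA K := sub (isDGIdeal_ker f).isDGSub

/-- The inclusion of the kernel. -/
def kerIncl (f : A ⟶ B) : kerObj f ⟶ A := incl (isDGIdeal_ker f).isDGSub

theorem app_kerIncl (f : A ⟶ B) (x : kerObj f) : app f (app (kerIncl f) x) = 0 :=
  incl_mem (isDGIdeal_ker f).isDGSub x

theorem kerIncl_injective (f : A ⟶ B) : Function.Injective (app (kerIncl f)) :=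
  incl_injective (isDGIdeal_ker f).isDGSub

/-- A morphism with values in the kernel. -/
def kerFactor (f : A ⟶ B) (g : X ⟶ A) (h : ∀ x, app f (app g x) = 0) : X ⟶ kerObj f :=
  factor (isDGIdeal_ker f).isDGSub g h

theorem exists_kerIncl_eq (f : A ⟶ B) {a : A} (h : app f a = 0) :
    ∃ x, app (kerIncl f) x = a := ⟨⟨a, h⟩, rfl⟩

theorem kerObj_isComplex {f : A ⟶ B} (h : ∀ a x, app f x = 0 → a * x = 0) :
    (kerObj f).IsComplex :=
  sub_isComplex _ fun x _ y hy => h x y hy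

theorem kerObj_isAcyclic {f : A ⟶ B} (h : IsAcyclicSmallExtension f) :
    (kerObj f).IsAcyclic := by
  intro x hx
  obtain ⟨y, hy, hxy⟩ := h.acyclic_ker (app (kerIncl f) x) (app_kerIncl f x)
    (by rw [← app_d, hx, map_zero])
  obtain ⟨y, rfl⟩ := exists_kerIncl_eq f hy
  exact ⟨y, kerIncl_injective f ((app_d _ _).trans hxy)⟩

/-- The difference of two liftings, with values in the kernel of a small extension. -/
def diff {f : A ⟶ B} (hf : IsSmallExtension f) (g h : X ⟶ A) (e : g ≫ f = h ≫ f) :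
    X ⟶ kerObj f :=
  have e' : ∀ x, app f (app h x - app g x) = 0 := fun x => by
    rw [map_sub, sub_eq_zero]
    exact congrArg (fun k => app k x) e.symm
  kerFactor f
    (Hom.mk
      { toFun := fun x => app h x - app g x
        map_smul' := fun r x => by simp [smul_sub]
        map_zero' := by simp
        map_add' := fun x y => by simp only [map_add]; abel
        map_mul' := fun x y => by
          -- The difference is multiplicative for a degenerate reason: each summand has a factor in
          -- the kernel and vanishes, as does the product of two differences.
          have h1 : app h x * app h y - app g x * app g y =
              app h x * (app h y - app g y) + (app h x - app g x) * app g y := by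
            rw [mul_sub, sub_mul]; abel
          rw [map_mul, map_mul, h1, hf.mul_ker _ _ (e' y), hf.mul_ker _ _ (e' y),
            hf.ker_mul _ _ (e' x), add_zero] }
      (fun hx => sub_mem (S := Submodule K A) (app_gr h hx) (app_gr g hx))
      (fun x => by
        change app h (X.d x) - app g (X.d x) = A.d (app h x - app g x)
        rw [app_d, app_d, map_sub]))
    e'

/-- The translate of a morphism by a morphism to the kernel of a small extension. -/
def translate {f : A ⟶ B} (hf : IsSmallExtension f) (g : X ⟶ A) (m : X ⟶ kerObj f) : X ⟶ A :=
  Hom.mk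
    { toFun := fun x => app g x + app (kerIncl f) (app m x)
      map_smul' := fun r x => by simp [smul_add]
      map_zero' := by simp
      map_add' := fun x y => by simp only [map_add]; abel
      map_mul' := fun x y => by
        simp only [map_mul, mul_add, add_mul, hf.mul_ker _ _ (app_kerIncl f _),
          hf.ker_mul _ _ (app_kerIncl f _), add_zero] }
    (fun hx => add_mem (S := Submodule K A) (app_gr g hx) (app_gr (kerIncl f) (app_gr m hx)))
    (fun x => by
      change app g (X.d x) + app (kerIncl f) (app m (X.d x)) = A.d (app g x + _)
      rw [app_d, app_d, app_d, map_add])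

@[simp] theorem app_translate {f : A ⟶ B} (hf : IsSmallExtension f) (g : X ⟶ A)
    (m : X ⟶ kerObj f) (x : X) :
    app (translate hf g m) x = app g x + app (kerIncl f) (app m x) := rfl

theorem translate_comp {f : A ⟶ B} (hf : IsSmallExtension f) (g : X ⟶ A) (m : X ⟶ kerObj f) :
    translate hf g m ≫ f = g ≫ f :=
  hom_ext fun x => by simp [app_kerIncl]

end Small

end NilpDGA

/-! ### The action of the kernel on the fibres -/

namespace IsPredeformation

variable {F G : NilpDGA K ⥤ Type v} {A B C : NilpDGA K}

theorem exists_fiber (hF : IsPredeformation F) (α : A ⟶ C) (β : B ⟶ C)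
    (hα : Function.Surjective (app α)) (x : F.obj A) (y : F.obj B)
    (h : F.map α x = F.map β y) :
    ∃ z : F.obj (fiberProd α β), F.map (fst α β) z = x ∧ F.map (snd α β) z = y := by
  obtain ⟨z, hz⟩ := hF.surjective α β hα ⟨(x, y), h⟩
  exact ⟨z, congrArg (fun p => p.1.1) hz, congrArg (fun p => p.1.2) hz⟩

theorem fiber_ext (hF : IsPredeformation F) (α : A ⟶ C) (β : B ⟶ C)
    (hα : Function.Surjective (app α)) (hC : C.IsComplex) (hC' : C.IsAcyclic)
    {z z' : F.obj (fiberProd α β)} (h1 : F.map (fst α β) z = F.map (fst α β) z')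
    (h2 : F.map (snd α β) z = F.map (snd α β) z') : z = z' :=
  (hF.bijective α β hα hC hC').1 (Subtype.ext (Prod.ext h1 h2))

theorem zero_ext (hF : IsPredeformation F) (x y : F.obj (NilpDGA.zero K)) : x = y :=
  (hF.zero.some.uniq x).trans (hF.zero.some.uniq y).symm

theorem prod_ext (hF : IsPredeformation F) {z z' : F.obj (prod A B)}
    (h1 : F.map (fst _ _) z = F.map (fst _ _) z')
    (h2 : F.map (snd _ _) z = F.map (snd _ _) z') : z = z' :=
  (hF.prod_bijective A B).1 (Prod.ext h1 h2)

/-- `A ×_B A` is a retract of `A × ker f` through `(a, a') ↦ (a, a' - a)`, and `F` preserves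
products. So the first projection and the difference determine `z`, although the two projections
need not. -/
theorem difference_ext (hF : IsPredeformation F) {f : A ⟶ B} (hf : IsSmallExtension f)
    {z z' : F.obj (fiberProd f f)} (h1 : F.map (fst f f) z = F.map (fst f f) z')
    (h2 : F.map (diff hf (fst f f) (snd f f) (fiber_condition f f)) z =
      F.map (diff hf (fst f f) (snd f f) (fiber_condition f f)) z') : z = z' := by
  let p : fiberProd f f ⟶ prod A (kerObj f) :=
    lift _ _ (fst f f) (diff hf (fst f f) (snd f f) (fiber_condition f f)) rfl
  let q : prod A (kerObj f) ⟶ fiberProd f f :=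
    lift f f (fst _ _) (translate hf (fst _ _) (snd _ _)) (translate_comp hf _ _).symm
  have hpq : p ≫ q = 𝟙 _ := hom_ext fun x => Subtype.ext (Prod.ext rfl (by
    change x.1.1 + (x.1.2 - x.1.1) = x.1.2
    abel))
  have h : F.map p z = F.map p z' := by
    refine hF.prod_ext ?_ ?_
    · rw [← Functor.map_comp_apply, ← Functor.map_comp_apply]
      exact h1
    · rw [← Functor.map_comp_apply, ← Functor.map_comp_apply]
      exact h2
  have h' := congrArg (F.map q) h
  rwa [← Functor.map_comp_apply, ← Functor.map_comp_apply, hpq, Functor.map_id_apply,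
    Functor.map_id_apply] at h'

theorem exists_difference (hF : IsPredeformation F) {f : A ⟶ B} (hf : IsSmallExtension f)
    (x : F.obj A) (m : F.obj (kerObj f)) : ∃ z : F.obj (fiberProd f f),
      F.map (fst f f) z = x ∧
      F.map (diff hf (fst f f) (snd f f) (fiber_condition f f)) z = m := by
  let q : prod A (kerObj f) ⟶ fiberProd f f :=
    lift f f (fst _ _) (translate hf (fst _ _) (snd _ _)) (translate_comp hf _ _).symm
  have hq : q ≫ diff hf (fst f f) (snd f f) (fiber_condition f f) = snd _ _ :=
    hom_ext fun x => kerIncl_injective f (by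
      change (x.1.1 + app (kerIncl f) x.1.2) - x.1.1 = app (kerIncl f) x.1.2
      abel)
  refine ⟨F.map q (hF.pair (A := A) (B := kerObj f) x m), ?_, ?_⟩
  · rw [← Functor.map_comp_apply]
    exact (hF.pair_spec x m).1
  · rw [← Functor.map_comp_apply, hq]
    exact (hF.pair_spec x m).2

/-- Lifts to a small extension can be adjusted if the kernels are comparable. -/
theorem exists_adjust (hF : IsPredeformation F) (hG : IsPredeformation G) (θ : F ⟶ G)
    (hθ : ∀ A : NilpDGA K, A.IsComplex → Function.Bijective (θ.app A)) {f : A ⟶ B}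
    (hf : IsSmallExtension f) (x : F.obj A) (y : G.obj A)
    (h : G.map f (θ.app A x) = G.map f y) :
    ∃ x' : F.obj A, θ.app A x' = y ∧ F.map f x' = F.map f x := by
  obtain ⟨z, hz1, hz2⟩ := hG.exists_fiber f f hf.surjective _ _ h
  -- The difference from `θ x` to `y` is a class on the kernel, a complex, so it comes from some `m`
  -- in `F`; translating `x` by `m` then gives the required lift.
  obtain ⟨m, hm⟩ := (hθ _ (kerObj_isComplex hf.mul_ker)).2
    (G.map (diff hf (fst f f) (snd f f) (fiber_condition f f)) z)
  obtain ⟨w, hw1, hw2⟩ := hF.exists_difference hf x m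
  have hwz : θ.app _ w = z := by
    refine hG.difference_ext hf ?_ ?_
    · rw [← NatTrans.naturality_apply, hw1, hz1]
    · rw [← NatTrans.naturality_apply, hw2, hm]
  refine ⟨F.map (snd f f) w, ?_, ?_⟩
  · rw [NatTrans.naturality_apply, hwz, hz2]
  · rw [← Functor.map_comp_apply, ← fiber_condition, Functor.map_comp_apply, hw1]

end IsPredeformation

/-! ### The relative cone of a small extension -/

section Cone

variable {A B : NilpDGA K} {f : A ⟶ B}

theorem NilpDGA.IsSmallExtension.coneSnd_mul_eq_zero (hf : IsSmallExtension f) (x y : cone A)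
    (hx : app f (coneSnd A x) = 0) (hy : app f (coneSnd A y) = 0) : coneSnd A (x * y) = 0 := by
  rw [coneSnd_mul, hf.mul_ker _ _ hy, hf.ker_mul _ _ hx, add_zero]

variable (f) in
/-- The mapping cone of the inclusion of the kernel of `f : A ⟶ B`, consisting of the
`a + b u` with `f b = 0`. -/
noncomputable abbrev relCone : NilpDGA K := sub (isDGSub_comap_coneSnd (isDGIdeal_ker f))

variable (f) in
/-- The projection `a + b u ↦ f a`. -/
noncomputable def relConeHom : relCone f ⟶ B :=
  have hW := isDGSub_comap_coneSnd (isDGIdeal_ker f)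
  Hom.mk
    { toFun := fun x => app f (coneFst A (app (incl hW) x))
      map_smul' := fun r x => by simp
      map_zero' := by simp
      map_add' := fun x y => by simp
      map_mul' := fun x y => by simp }
    (fun hx => app_gr f (coneFst_mem (app_gr (incl hW) hx)))
    (fun x => by
      change app f (coneFst A (app (incl hW) ((relCone f).d x))) = B.d (app f _)
      have h : app f (A.sgn (coneSnd A (app (incl hW) x))) = 0 :=
        sgn_mem_of_proj_mem (isDGIdeal_ker f).proj_mem (incl_mem hW x)
      rw [app_d, coneFst_d, map_add, h, add_zero, app_d])

variable (f) in
/-- The inclusion of the base of the relative cone. -/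
noncomputable def toRelCone : A ⟶ relCone f :=
  factor (isDGSub_comap_coneSnd (isDGIdeal_ker f)) (toCone A) fun _ => map_zero (app f)

/-- The kernel of `a + b u ↦ f a` is the cone of `ker f`, contracted by `a + b u ↦ sgn a u`;
smallness of `f` makes its products with the relative cone vanish. -/
theorem isAcyclicSmallExtension_relConeHom (hf : IsSmallExtension f) :
    IsAcyclicSmallExtension (relConeHom f) := by
  have hW := isDGSub_comap_coneSnd (isDGIdeal_ker f)
  have hsgn : ∀ a, app f a = 0 → app f (A.sgn a) = 0 := fun a ha =>
    sgn_mem_of_proj_mem (isDGIdeal_ker f).proj_mem ha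
  refine ⟨fun b => ?_, fun a x hx => ?_, fun x hx hdx => ?_⟩
  · obtain ⟨a, rfl⟩ := hf.surjective b
    exact ⟨app (toRelCone f) a, rfl⟩
  · have hx' : app f (coneFst A (app (incl hW) x)) = 0 := hx
    refine incl_injective hW ?_
    rw [map_mul, map_zero]
    refine cone_ext ?_ ?_
    · rw [coneFst_mul, hf.mul_ker _ _ hx', map_zero]
    · rw [hf.coneSnd_mul_eq_zero _ _ (incl_mem hW a) (incl_mem hW x), map_zero]
  · have hx' : app f (coneFst A (app (incl hW) x)) = 0 := hx
    have h1 := congrArg (coneFst A) (congrArg (app (incl hW)) hdx)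
    rw [app_d, coneFst_d, map_zero, map_zero] at h1
    obtain ⟨y, hy⟩ := exists_incl_eq hW
      (a := coneElt 0 (A.sgn (coneFst A (app (incl hW) x)))) (hsgn _ hx')
    refine ⟨y, ?_, incl_injective hW (cone_ext ?_ ?_)⟩
    · change app f (coneFst A (app (incl hW) y)) = 0
      rw [hy, coneFst_coneElt, map_zero]
    · rw [app_d, hy]
      simp
    · have h2 := congrArg A.sgn h1
      rw [map_add, sgn_sgn, sgn_d, map_zero, neg_add_eq_zero] at h2
      rw [app_d, hy]
      simp [h2]

end Cone

/-! ### Smoothness: lifting along surjections -/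

namespace IsPredeformation

variable {F G : NilpDGA K ⥤ Type v} {A B C : NilpDGA K}

/-- A morphism of predeformation functors which is bijective on complexes is smooth along small
extensions. -/
theorem exists_lift_of_isSmallExtension (hF : IsPredeformation F) (hG : IsPredeformation G)
    (θ : F ⟶ G) (hθ : ∀ A : NilpDGA K, A.IsComplex → Function.Bijective (θ.app A)) {f : A ⟶ B}
    (hf : IsSmallExtension f) (x : F.obj B) (y : G.obj A) (h : θ.app B x = G.map f y) :
    ∃ x' : F.obj A, θ.app A x' = y ∧ F.map f x' = x := by
  have hW := isDGSub_comap_coneSnd (isDGIdeal_ker f)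
  have hE := isAcyclicSmallExtension_relConeHom hf
  have h0 : ∀ x ∈ (LinearMap.ker (app f : A →ₗ[K] B)).comap (coneSnd A),
      ∀ y ∈ (LinearMap.ker (app f : A →ₗ[K] B)).comap (coneSnd A), coneSnd A (x * y) = 0 :=
    fun x hx y hy => hf.coneSnd_mul_eq_zero x y hx hy
  have hι : toRelCone f ≫ relConeHom f = f := rfl
  let q : relCone f ⟶ _ := quotMk (isDGIdeal_ker_subSnd hW h0)
  have hιq : toRelCone f ≫ q = zeroHom A (NilpDGA.zero K) ≫ zeroHom (NilpDGA.zero K) _ := hom_ext fun a =>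
    (quotMk_eq_zero (isDGIdeal_ker_subSnd hW h0)).2 rfl
  -- Lifts to the relative cone exist without obstruction. The adjustment makes the lift compatible
  -- with the image of `y`, which comes from `A`.
  obtain ⟨x₁, hx₁⟩ := hF.quasismooth _ hE x
  obtain ⟨x₂, hx₂, hx₂'⟩ := exists_adjust hF hG θ hθ hE.isSmallExtension x₁
    (G.map (toRelCone f) y) (by
      rw [← NatTrans.naturality_apply, hx₁, h, ← Functor.map_comp_apply, hι])
  -- The obstruction to bringing `x₂` down to `A` is its class in `F` of the quotient complex. Its
  -- image under `θ` comes from `y` and so factors through `G(0)`; injectivity of `θ` on complexes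
  -- then makes the class trivial.
  have hq : F.map q x₂ = F.map (zeroHom (NilpDGA.zero K) _) hF.zero.some.default := by
    refine (hθ _ (quot_ker_subSnd_isComplex hW h0)).1 ?_
    rw [NatTrans.naturality_apply, NatTrans.naturality_apply, hx₂, ← Functor.map_comp_apply, hιq,
      Functor.map_comp_apply]
    exact congrArg _ (hG.zero_ext _ _)
  obtain ⟨z, hz, -⟩ := hF.exists_fiber q _ (quotMk_surjective _) _ _ hq
  have hb : baseFiberHom hW h0 ≫ f = fst _ _ ≫ relConeHom f := rfl
  -- The image of `z` in `F(A)` already lifts `x`; a second adjustment, now along `f`, matches it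
  -- with `y`.
  obtain ⟨x₃, hx₃, hx₃'⟩ := exists_adjust hF hG θ hθ hf (F.map (baseFiberHom hW h0) z) y (by
    rw [← NatTrans.naturality_apply, ← Functor.map_comp_apply, hb, Functor.map_comp_apply]
    erw [hz]
    rw [hx₂', hx₁, h])
  refine ⟨x₃, hx₃, ?_⟩
  rw [hx₃', ← Functor.map_comp_apply, hb, Functor.map_comp_apply]
  erw [hz]
  rw [hx₂', hx₁]

/-- A morphism of predeformation functors which is bijective on complexes is smooth along
surjections. -/
theorem exists_lift (hF : IsPredeformation F) (hG : IsPredeformation G)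
    (θ : F ⟶ G) (hθ : ∀ A : NilpDGA K, A.IsComplex → Function.Bijective (θ.app A)) {f : A ⟶ B}
    (hf : Function.Surjective (app f)) (x : F.obj B) (y : G.obj A) (h : θ.app B x = G.map f y) :
    ∃ x' : F.obj A, θ.app A x' = y ∧ F.map f x' = x := by
  have hI := fun n => (isDGIdeal_ker f).inf (isDGIdeal_power A n)
  have hf0 : ∀ n, ∀ x ∈ LinearMap.ker (app f : A →ₗ[K] B) ⊓ power K A n, app f x = 0 :=
    fun _ _ hx => hx.1
  have key : ∀ n, ∃ x' : F.obj (quot (hI n)), θ.app _ x' = G.map (quotMk (hI n)) y ∧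
      F.map (desc (hI n) f (hf0 n)) x' = x := by
    intro n
    induction n with
    | zero =>
      -- As `power K A 0` is all of `A`, the first quotient is `A / ker f`, and the map to `B` has
      -- zero kernel.
      refine exists_lift_of_isSmallExtension hF hG θ hθ (f := desc (hI 0) f (hf0 0))
        ⟨fun b => ?_, fun a x hx => ?_⟩ x _ ?_
      · obtain ⟨a, rfl⟩ := hf b
        exact ⟨app (quotMk (hI 0)) a, rfl⟩
      · obtain ⟨x, rfl⟩ := quotMk_surjective _ x
        rw [(quotMk_eq_zero (hI 0)).2 ⟨hx, trivial⟩, mul_zero]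
      · rw [h, ← Functor.map_comp_apply, quotMk_desc]
    | succ n ih =>
      obtain ⟨x', hx', hx''⟩ := ih
      have hle : LinearMap.ker (app f : A →ₗ[K] B) ⊓ power K A (n + 1) ≤
          LinearMap.ker (app f : A →ₗ[K] B) ⊓ power K A n :=
        inf_le_inf_left _ (power_antitone A (Nat.le_succ n))
      have hsm : IsSmallExtension (quotMap (hI (n + 1)) (hI n) hle) := by
        refine ⟨fun b => ?_, fun a x hx => ?_⟩
        · obtain ⟨a, rfl⟩ := quotMk_surjective _ b
          exact ⟨app (quotMk (hI (n + 1))) a, rfl⟩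
        · obtain ⟨a, rfl⟩ := quotMk_surjective _ a
          obtain ⟨x, rfl⟩ := quotMk_surjective _ x
          have hx2 := (quotMk_eq_zero (hI n)).1 hx
          rw [← map_mul, quotMk_eq_zero]
          exact ⟨(isDGIdeal_ker f).mul_left a x hx2.1, mul_mem_power_succ a hx2.2⟩
      obtain ⟨x₁, hx₁, hx₁'⟩ := exists_lift_of_isSmallExtension hF hG θ hθ hsm x'
        (G.map (quotMk (hI (n + 1))) y) (by rw [hx', ← Functor.map_comp_apply]; rfl)
      refine ⟨x₁, hx₁, ?_⟩
      rw [← hx'', ← hx₁', ← Functor.map_comp_apply]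
      refine congrArg (fun k => F.map k x₁) (hom_ext fun a => ?_)
      obtain ⟨a, rfl⟩ := quotMk_surjective _ a
      rfl
  obtain ⟨n, hn⟩ := A.nilpotent
  obtain ⟨x', hx', hx''⟩ := key n
  obtain ⟨x₁, hx₁, hx₁'⟩ := exists_lift_of_isSmallExtension hF hG θ hθ (f := quotMk (hI n))
    ⟨quotMk_surjective _, fun a x hx => by
      have hx2 := ((quotMk_eq_zero (hI n)).1 hx).2
      rw [hn] at hx2
      rw [(Submodule.mem_bot K).1 hx2, mul_zero]⟩ x' y hx'
  refine ⟨x₁, hx₁, ?_⟩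
  rw [← hx'', ← hx₁', ← Functor.map_comp_apply, quotMk_desc]

end IsPredeformation

/-! ### Separated algebras -/

/-- An algebra `S` is separated for `F` if elements of `F(R ×_S T)` are determined by their images
in `F(R)` and `F(T)`, for `R ⟶ S` surjective. -/
def IsSeparated (F : NilpDGA K ⥤ Type v) (S : NilpDGA K) : Prop :=
  ∀ ⦃R T : NilpDGA K⦄ (α : R ⟶ S) (β : T ⟶ S), Function.Surjective (app α) →
    ∀ z z' : F.obj (fiberProd α β), F.map (fst α β) z = F.map (fst α β) z' →
      F.map (snd α β) z = F.map (snd α β) z' → z = z'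

namespace IsPredeformation

variable {F G : NilpDGA K ⥤ Type v} {A B C : NilpDGA K}

/-- `R ×_{S'} T` is the fibre over `0` of the map `(r, t) ↦ α r - β t` from `R ×_S T` to `ker π`.
That map is onto because `α` is, and its target is an acyclic complex, so the bijective case of
condition (2) applies. -/
theorem isSeparated_of_isAcyclicSmallExtension (hF : IsPredeformation F) {S S' : NilpDGA K}
    {π : S' ⟶ S} (hπ : IsAcyclicSmallExtension π) (hS : IsSeparated F S) : IsSeparated F S' := by
  intro R T α β hα z z' h1 h2
  let i : fiberProd α β ⟶ fiberProd (α ≫ π) (β ≫ π) :=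
    lift _ _ (fst α β) (snd α β) (by rw [← Category.assoc, fiber_condition, Category.assoc])
  have hi : F.map i z = F.map i z' := by
    refine hS (α ≫ π) (β ≫ π) (hπ.surjective.comp hα) _ _ ?_ ?_
    · rw [← Functor.map_comp_apply, ← Functor.map_comp_apply]
      exact h1
    · rw [← Functor.map_comp_apply, ← Functor.map_comp_apply]
      exact h2
  let δ : fiberProd (α ≫ π) (β ≫ π) ⟶ kerObj π :=
    diff hπ.isSmallExtension (snd _ _ ≫ β) (fst _ _ ≫ α) (fiber_condition (α ≫ π) (β ≫ π)).symm
  have hδ : Function.Surjective (app δ) := by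
    intro m
    obtain ⟨r, hr⟩ := hα (app (kerIncl π) m)
    have hr' : app (α ≫ π) r = app (β ≫ π) 0 := by
      rw [app_comp, hr, app_kerIncl, map_zero]
    refine ⟨⟨(r, 0), hr'⟩, kerIncl_injective π ?_⟩
    change app α r - app β 0 = _
    rw [hr, map_zero, sub_zero]
  let j : fiberProd α β ⟶ fiberProd δ (zeroHom (NilpDGA.zero K) _) :=
    lift _ _ i (zeroHom _ (NilpDGA.zero K)) (hom_ext fun x => kerIncl_injective π (by
      change app α x.1.1 - app β x.1.2 = 0
      rw [sub_eq_zero]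
      exact x.2))
  let k : fiberProd δ (zeroHom (NilpDGA.zero K) _) ⟶ fiberProd α β :=
    lift α β (fst _ _ ≫ fst _ _) (fst _ _ ≫ snd _ _) (hom_ext fun x => by
      have h := congrArg (app (kerIncl π)) x.2
      exact sub_eq_zero.1 h)
  have hjk : j ≫ k = 𝟙 _ := rfl
  have hj : F.map j z = F.map j z' := by
    refine hF.fiber_ext δ _ hδ (kerObj_isComplex hπ.mul_ker) (kerObj_isAcyclic hπ) ?_
      (hF.zero_ext _ _)
    rw [← Functor.map_comp_apply, ← Functor.map_comp_apply]
    exact hi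
  have h' := congrArg (F.map k) hj
  rwa [← Functor.map_comp_apply, ← Functor.map_comp_apply, hjk, Functor.map_id_apply,
    Functor.map_id_apply] at h'

/-- Over the acyclic complex `hQ`, an element of `G` of the fibre is determined by its image in `G`
of the subalgebra, since `G(0)` is a point. The retraction `k` transfers this to `B`. -/
theorem injective_map_of_baseFiber (hG : IsPredeformation G) {W : Submodule K (cone A)}
    (hW : IsDGSub (cone A) W) (h0 : ∀ x ∈ W, ∀ y ∈ W, coneSnd A (x * y) = 0)
    (hQ : (quot (isDGIdeal_ker_subSnd hW h0)).IsAcyclic) (g : B ⟶ sub hW)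
    (hg : ∀ x, coneSnd A (app (incl hW) (app g x)) = 0) (k : baseFiber hW h0 ⟶ B)
    (hk : toBaseFiber hW h0 g hg ≫ k = 𝟙 B) : Function.Injective (G.map g) := by
  intro m m' hm
  have hj : G.map (toBaseFiber hW h0 g hg) m = G.map (toBaseFiber hW h0 g hg) m' := by
    refine hG.fiber_ext _ _ (quotMk_surjective _) (quot_ker_subSnd_isComplex hW h0) hQ ?_
      (hG.zero_ext _ _)
    rw [← Functor.map_comp_apply, ← Functor.map_comp_apply]
    exact hm
  have h' := congrArg (G.map k) hj
  rwa [← Functor.map_comp_apply, ← Functor.map_comp_apply, hk, Functor.map_id_apply,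
    Functor.map_id_apply] at h'

/-- The quotient is the cone of `A / I`. Filtering by the ideals `A^n + I` builds it from `0` by
acyclic small extensions, because cones are acyclic, and separatedness climbs the tower. -/
theorem isSeparated_quot_coneIdeal (hF : IsPredeformation F) {I : Submodule K A}
    (hI : IsDGIdeal A I) (h0 : ∀ a, ∀ x ∈ I, a * x = 0) :
    IsSeparated F (quot (isDGIdeal_coneIdeal hI)) := by
  -- The ideal is a variable tied by an equation, so that the last stage applies to `I` itself
  -- instead of `⊥ ⊔ I`.
  have key : ∀ n, ∀ J (hJ : IsDGIdeal A J), J = power K A n ⊔ I →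
      IsSeparated F (quot (isDGIdeal_coneIdeal hJ)) := by
    intro n
    induction n with
    | zero =>
      intro J hJ hJ'
      have h1 : ∀ x : quot (isDGIdeal_coneIdeal hJ), x = 0 := fun x => by
        obtain ⟨x, rfl⟩ := quotMk_surjective _ x
        rw [quotMk_eq_zero]
        subst hJ'
        exact ⟨Submodule.mem_sup_left trivial, Submodule.mem_sup_left trivial⟩
      intro R T α β hα z z' hz hz'
      exact hF.fiber_ext α β hα (fun a b => h1 _) (fun a _ => ⟨0, (h1 _).trans (h1 a).symm⟩) hz hz'
    | succ n ih =>
      intro J hJ hJ'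
      have hJn := (isDGIdeal_power A n).sup hI
      have hle : J ≤ power K A n ⊔ I :=
        hJ'.le.trans (sup_le_sup_right (power_antitone A (Nat.le_succ n)) I)
      have hmul : ∀ a, ∀ x ∈ power K A n ⊔ I, a * x ∈ J := fun a x hx => by
        obtain ⟨y, hy, m, hm, rfl⟩ := Submodule.mem_sup.1 hx
        rw [mul_add, h0 a m hm, add_zero, hJ']
        exact Submodule.mem_sup_left (mul_mem_power_succ a hy)
      exact hF.isSeparated_of_isAcyclicSmallExtension
        (isAcyclicSmallExtension_quotMap (isDGIdeal_coneIdeal hJ) (isDGIdeal_coneIdeal hJn)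
          (fun x hx => ⟨hle hx.1, hle hx.2⟩) (fun a x hx => mul_mem_coneIdeal hJn hmul a hx)
          fun x hx hdx => coneIdeal_acyclic hJ hJn hx hdx) (ih _ hJn rfl)
  obtain ⟨n, hn⟩ := A.nilpotent
  exact key n I hI (by rw [hn, bot_sup_eq])

end IsPredeformation

/-! ### The kernel inside its cone -/

section ConeQuot

variable {A B : NilpDGA K} (f : A ⟶ B)

/-- The projection of the cone of `A` onto its quotient by the cone of the kernel of `f`. -/
noncomputable abbrev coneQuot : cone A ⟶ quot (isDGIdeal_coneIdeal (isDGIdeal_ker f)) :=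
  quotMk (isDGIdeal_coneIdeal (isDGIdeal_ker f))

/-- The inclusion of the kernel of `f` in its cone. -/
noncomputable def kerToConeKer : kerObj f ⟶ kerObj (coneQuot f) :=
  kerFactor (coneQuot f) (kerIncl f ≫ toCone A) fun x =>
    (quotMk_eq_zero (isDGIdeal_coneIdeal (isDGIdeal_ker f))).2
      ⟨app_kerIncl f x, map_zero (app f)⟩

variable {f}

theorem isSmallExtension_coneQuot (hf : IsSmallExtension f) : IsSmallExtension (coneQuot f) := by
  have hI := isDGIdeal_ker f
  refine ⟨quotMk_surjective _, fun a x hx => ?_⟩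
  have h := mul_mem_coneIdeal (I := ⊥) hI (fun a x hx => hf.mul_ker a x hx) a
    ((quotMk_eq_zero (isDGIdeal_coneIdeal hI)).1 hx)
  exact cone_ext h.1 h.2

/-- The kernel `I` of `f` is the fibre over `0` of `I ⊕ I u → I u`, and this quotient is acyclic
because `I` is. -/
theorem IsPredeformation.map_kerToConeKer_injective {G : NilpDGA K ⥤ Type v}
    (hG : IsPredeformation G) (hf : IsAcyclicSmallExtension f) :
    Function.Injective (G.map (kerToConeKer f)) := by
  have hC := isDGIdeal_coneIdeal (isDGIdeal_ker f)
  have hp := isSmallExtension_coneQuot hf.isSmallExtension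
  have hW := (isDGIdeal_ker (coneQuot f)).isDGSub
  have h0 : ∀ x ∈ LinearMap.ker (app (coneQuot f) : cone A →ₗ[K] quot hC),
      ∀ y ∈ LinearMap.ker (app (coneQuot f) : cone A →ₗ[K] quot hC), coneSnd A (x * y) = 0 :=
    fun x _ y hy => by rw [hp.mul_ker x y hy, map_zero]
  have hQ : (quot (isDGIdeal_ker_subSnd hW h0)).IsAcyclic := by
    refine quot_ker_subSnd_isAcyclic hW h0 fun x hx hdx => ?_
    obtain ⟨y, hy, hxy⟩ := hf.acyclic_ker _ ((quotMk_eq_zero hC).1 hx).2 hdx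
    exact ⟨coneElt 0 y, (quotMk_eq_zero hC).2 ⟨map_zero (app f), hy⟩, hxy⟩
  have hg : ∀ x, coneSnd A (app (incl hW) (app (kerToConeKer f) x)) = 0 := fun x => rfl
  let k : baseFiber hW h0 ⟶ kerObj f := kerFactor f (baseFiberHom hW h0) fun x =>
    ((quotMk_eq_zero hC).1 (incl_mem hW (app (fst _ _) x))).1
  refine hG.injective_map_of_baseFiber hW h0 hQ (kerToConeKer f) hg k (hom_ext fun x => ?_)
  exact kerIncl_injective f rfl

end ConeQuot

/-! ### Uniqueness along acyclic small extensions -/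

namespace IsPredeformation

variable {F G : NilpDGA K ⥤ Type v} {A B C : NilpDGA K}

/-- For an acyclic small extension `A ⟶ B`, an element of `F(A)` is determined by its images in
`F(B)` and `G(A)`. -/
theorem ext_of_isAcyclicSmallExtension (hF : IsPredeformation F) (hG : IsPredeformation G)
    (θ : F ⟶ G) (hθ : ∀ A : NilpDGA K, A.IsComplex → Function.Bijective (θ.app A)) {f : A ⟶ B}
    (hf : IsAcyclicSmallExtension f) {x y : F.obj A} (h1 : F.map f x = F.map f y)
    (h2 : θ.app A x = θ.app A y) : x = y := by
  have hI := isDGIdeal_ker f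
  have hfs := hf.isSmallExtension
  have hsep := hG.isSeparated_quot_coneIdeal hI fun a x hx => hf.mul_ker a x hx
  let p := coneQuot f
  have hp : IsSmallExtension p := isSmallExtension_coneQuot hfs
  let κ : kerObj f ⟶ kerObj p := kerToConeKer f
  have hκ : Function.Injective (G.map κ) := hG.map_kerToConeKer_injective hf
  obtain ⟨z, hz1, hz2⟩ := hF.exists_fiber f f hf.surjective _ _ h1
  let Δ : A ⟶ fiberProd f f := lift f f (𝟙 A) (𝟙 A) rfl
  have hΔ1 : ∀ {H : NilpDGA K ⥤ Type v} (a : H.obj A), H.map (fst f f) (H.map Δ a) = a :=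
    fun {H} a => by rw [← Functor.map_comp_apply, lift_fst, Functor.map_id_apply]
  have hΔ2 : ∀ {H : NilpDGA K ⥤ Type v} (a : H.obj A), H.map (snd f f) (H.map Δ a) = a :=
    fun {H} a => by rw [← Functor.map_comp_apply, lift_snd, Functor.map_id_apply]
  let D := diff hfs (fst f f) (snd f f) (fiber_condition f f)
  -- Nothing ensures that an element of `G(A ×_B A)` is determined by its projections. Passing to
  -- the cone replaces the base by the separated quotient of `hsep`.
  let e : fiberProd f f ⟶ fiberProd p p := lift p p (fst f f ≫ toCone A) (snd f f ≫ toCone A)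
    (hom_ext fun x => by
      refine sub_eq_zero.1 ((map_sub (app p) (app (toCone A) x.1.1) (app (toCone A) x.1.2)).symm.trans
        ((quotMk_eq_zero (isDGIdeal_coneIdeal hI)).2 ⟨?_, ?_⟩))
      · change app f (x.1.1 - x.1.2) = 0
        rw [map_sub, sub_eq_zero]
        exact x.2
      · change app f ((0 : A) - 0) = 0
        rw [sub_zero, map_zero])
  have hDκ : D ≫ κ = e ≫ diff hp (fst p p) (snd p p) (fiber_condition p p) :=
    hom_ext fun x => kerIncl_injective p (map_sub (app (toCone A)) x.1.2 x.1.1)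
  -- Both elements project to the image of `θ x` on either side, by `h2` for the second.
  have he : G.map e (θ.app _ z) = G.map e (G.map Δ (θ.app A x)) := by
    refine hsep p p hp.surjective _ _ ?_ ?_
    · rw [← Functor.map_comp_apply, ← Functor.map_comp_apply, lift_fst, Functor.map_comp_apply,
        Functor.map_comp_apply, hΔ1, ← NatTrans.naturality_apply, hz1]
    · rw [← Functor.map_comp_apply, ← Functor.map_comp_apply, lift_snd, Functor.map_comp_apply,
        Functor.map_comp_apply, hΔ2, ← NatTrans.naturality_apply, hz2, h2]
  -- The differences are compared in `F(ker f)`: `θ` moves the question to `G(ker f)`, and `hκ`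
  -- moves it on to the kernel of `p`, where `he` decides.
  have hz : z = F.map Δ x := by
    refine hF.difference_ext hfs (by rw [hΔ1, hz1]) ?_
    refine (hθ _ (kerObj_isComplex hf.mul_ker)).1 (hκ ?_)
    rw [NatTrans.naturality_apply, NatTrans.naturality_apply, NatTrans.naturality_apply,
      ← Functor.map_comp_apply, ← Functor.map_comp_apply]
    change G.map (D ≫ κ) _ = G.map (D ≫ κ) _
    rw [hDκ, Functor.map_comp_apply, Functor.map_comp_apply, he]
  rw [← hz2, hz, hΔ2]

/-- Elements of `F(A)` are determined by their images in `G(A)` and in `F(A / J 0)`, if the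
filtration `J` of `A` has acyclic quotients. -/
theorem ext_of_filtration (hF : IsPredeformation F) (hG : IsPredeformation G)
    (θ : F ⟶ G) (hθ : ∀ A : NilpDGA K, A.IsComplex → Function.Bijective (θ.app A))
    (J : ℕ → Submodule K A) (hJ : ∀ n, IsDGIdeal A (J n)) (hle : ∀ n, J (n + 1) ≤ J n)
    (hmul : ∀ n a, ∀ x ∈ J n, a * x ∈ J (n + 1))
    (hd : ∀ n, ∀ x ∈ J n, A.d x ∈ J (n + 1) → ∃ y ∈ J n, x - A.d y ∈ J (n + 1))
    {N : ℕ} (hN : J N = ⊥) {x y : F.obj A}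
    (h1 : F.map (quotMk (hJ 0)) x = F.map (quotMk (hJ 0)) y)
    (h2 : θ.app A x = θ.app A y) : x = y := by
  have key : ∀ n, F.map (quotMk (hJ n)) x = F.map (quotMk (hJ n)) y := by
    intro n
    induction n with
    | zero => exact h1
    | succ n ih =>
      refine ext_of_isAcyclicSmallExtension hF hG θ hθ
        (isAcyclicSmallExtension_quotMap (hJ (n + 1)) (hJ n) (hle n) (hmul n) (hd n)) ?_ ?_
      · rw [← Functor.map_comp_apply, ← Functor.map_comp_apply]
        exact ih
      · rw [NatTrans.naturality_apply, NatTrans.naturality_apply, h2]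
  refine ext_of_isAcyclicSmallExtension hF hG θ hθ (isAcyclicSmallExtension_of_bijective
    (quotMk (hJ N)) ⟨(injective_iff_map_eq_zero _).2 fun a ha => ?_, quotMk_surjective _⟩)
    (key N) h2
  have h := (quotMk_eq_zero (hJ N)).1 ha
  rwa [hN, Submodule.mem_bot] at h

end IsPredeformation

/-! ### Polynomials with coefficients in the powers of the algebra -/

namespace NilpDGA

section Seq

variable (A : NilpDGA K)

/-- The sequences `f` with `f n` in the `n`-th member `A, A, A², A³, …` of the power filtration,
viewed as polynomials `∑ f n t ^ n`. -/
def seqSubmodule : Submodule K (ℕ → A) where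
  carrier := {f | ∀ n, f n ∈ power K A (n - 1)}
  add_mem' hf hg n := add_mem (hf n) (hg n)
  zero_mem' n := zero_mem (power K A (n - 1))
  smul_mem' r _ hf n := Submodule.smul_mem _ r (hf n)

/-- The vector space of polynomials `∑ f n t ^ n` with `f n ∈ A ^ n` for `n ≥ 1`. -/
def SeqCarrier : Type u := seqSubmodule A

instance : AddCommGroup (SeqCarrier A) := inferInstanceAs (AddCommGroup (seqSubmodule A))

instance : Module K (SeqCarrier A) := inferInstanceAs (Module K (seqSubmodule A))

/-- The coefficients of a polynomial. -/
def coeff (n : ℕ) : SeqCarrier A →ₗ[K] A := LinearMap.proj n ∘ₗ (seqSubmodule A).subtype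

variable {A}

/-- The polynomial with given coefficients. -/
def mkSeq (f : ℕ → A) (hf : ∀ n, f n ∈ power K A (n - 1)) : SeqCarrier A := ⟨f, hf⟩

@[simp] theorem coeff_mkSeq (f : ℕ → A) (hf : ∀ n, f n ∈ power K A (n - 1)) (n : ℕ) :
    coeff A n (mkSeq f hf) = f n := rfl

theorem coeff_mem (n : ℕ) (x : SeqCarrier A) : coeff A n x ∈ power K A (n - 1) := x.2 n

theorem seq_ext {x y : SeqCarrier A} (h : ∀ n, coeff A n x = coeff A n y) : x = y :=
  Subtype.ext (funext h)

theorem coeff_eq_zero {N n : ℕ} (hN : power K A N = ⊥) (h : N < n) (x : SeqCarrier A) :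
    coeff A n x = 0 := by
  have h1 := power_antitone A (show N ≤ n - 1 by omega) (coeff_mem n x)
  rwa [hN, Submodule.mem_bot] at h1

/-- Coefficients beyond `N` lie in a vanishing power of `A`. This is the reason for the filtration:
all polynomials over a nonzero `A` would form an infinite-dimensional space. -/
instance : FiniteDimensional K (SeqCarrier A) := by
  obtain ⟨N, hN⟩ := A.nilpotent
  refine Module.Finite.of_injective
    (LinearMap.pi fun i : Fin (N + 1) => coeff A i : SeqCarrier A →ₗ[K] Fin (N + 1) → A) ?_
  intro x y h
  refine seq_ext fun n => ?_
  by_cases hn : n < N + 1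
  · exact congrFun h ⟨n, hn⟩
  · rw [coeff_eq_zero hN (by omega), coeff_eq_zero hN (by omega)]

instance : Mul (SeqCarrier A) :=
  ⟨fun x y => mkSeq (fun n => ∑ p ∈ Finset.HasAntidiagonal.antidiagonal n, coeff A p.1 x * coeff A p.2 y)
    fun n => Submodule.sum_mem _ fun p hp => by
      rw [Finset.HasAntidiagonal.mem_antidiagonal] at hp
      -- With truncated subtraction, `(i - 1) + (j - 1) + 1 ≥ i + j - 1`.
      exact power_antitone A (by omega) (A.mul_mem_power (coeff_mem p.1 x) (coeff_mem p.2 y))⟩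

theorem coeff_mul (n : ℕ) (x y : SeqCarrier A) :
    coeff A n (x * y) = ∑ p ∈ Finset.HasAntidiagonal.antidiagonal n, coeff A p.1 x * coeff A p.2 y := rfl

instance : NonUnitalRing (SeqCarrier A) where
  left_distrib x y z := seq_ext fun n => by
    simp only [coeff_mul, map_add, mul_add, Finset.sum_add_distrib]
  right_distrib x y z := seq_ext fun n => by
    simp only [coeff_mul, map_add, add_mul, Finset.sum_add_distrib]
  zero_mul x := seq_ext fun n => by simp [coeff_mul]
  mul_zero x := seq_ext fun n => by simp [coeff_mul]
  mul_assoc x y z := seq_ext fun n => by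
    simp only [coeff_mul, Finset.sum_mul, Finset.mul_sum, Finset.sum_sigma']
    apply Finset.sum_nbij' (fun ⟨⟨_i, j⟩, ⟨k, l⟩⟩ ↦ ⟨(k, l + j), (l, j)⟩)
      (fun ⟨⟨i, _j⟩, ⟨k, l⟩⟩ ↦ ⟨(i + k, l), (i, k)⟩) <;>
      simp +contextual [add_assoc, mul_assoc]
    rintro ⟨⟨_, _⟩, ⟨_, _⟩⟩ h1 h2
    simp only at *
    omega

/-- The coefficientwise action of a linear map which preserves the power filtration. -/
def mapSeq (f : A →ₗ[K] A) (hf : ∀ n, ∀ a ∈ power K A n, f a ∈ power K A n) :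
    SeqCarrier A →ₗ[K] SeqCarrier A where
  toFun x := mkSeq (fun n => f (coeff A n x)) fun n => hf _ _ (coeff_mem n x)
  map_add' x y := seq_ext fun n => by simp
  map_smul' r x := seq_ext fun n => by simp

@[simp] theorem coeff_mapSeq (f : A →ₗ[K] A) (hf : ∀ n, ∀ a ∈ power K A n, f a ∈ power K A n)
    (n : ℕ) (x : SeqCarrier A) : coeff A n (mapSeq f hf x) = f (coeff A n x) := rfl

variable (A) in
/-- The algebra of polynomials `∑ f n t ^ n` with `f n ∈ A ^ n` for `n ≥ 1`. -/
noncomputable def seq : NilpDGA K where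
  carrier := SeqCarrier A
  scalarTower := ⟨fun r x y => seq_ext fun n => by
    simp [coeff_mul, smul_mul_assoc, Finset.smul_sum]⟩
  smulComm := ⟨fun r x y => seq_ext fun n => by
    simp [coeff_mul, mul_smul_comm, Finset.smul_sum]⟩
  gr i :=
    { carrier := {x | ∀ n, coeff A n x ∈ A.gr i}
      add_mem' := fun hx hy n => add_mem (S := Submodule K A) (hx n) (hy n)
      zero_mem' := fun n => zero_mem (A.gr i)
      smul_mem' := fun r x hx n => Submodule.smul_mem (A.gr i) r (hx n) }
  isInternal := by
    refine isInternal_of_proj _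
      (fun i => mapSeq (A.proj i) fun n => (A.isDGIdeal_power n).proj_mem i) ?_ ?_ ?_
    · exact fun i x n => A.proj_mem i _
    · intro i x hx j
      refine seq_ext fun n => (A.proj_of_mem (hx n) j).trans ?_
      split_ifs <;> simp
    · intro x
      obtain ⟨s, hs⟩ := A.exists_forall_sum_proj_eq
      refine ⟨s, seq_ext fun n => ?_⟩
      rw [map_sum]
      exact hs s subset_rfl _
  mul_mem {i j _ _} hx hy n := by
    change coeff A n (_ * _) ∈ A.gr (i + j)
    rw [coeff_mul]
    exact Submodule.sum_mem _ fun p _ => A.mul_mem (hx p.1) (hy p.2)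
  graded_comm {i j x y} hx hy := seq_ext fun n => by
    rw [Units.smul_def, map_zsmul, coeff_mul, coeff_mul, Finset.smul_sum,
      ← Finset.Nat.sum_antidiagonal_swap]
    exact Finset.sum_congr rfl fun p _ => A.graded_comm (hx p.2) (hy p.1)
  d := mapSeq A.d fun n => (A.isDGIdeal_power n).d_mem
  d_mem hx n := A.d_mem (hx n)
  d_d x := seq_ext fun n => A.d_d _
  leibniz {i x} y hx := seq_ext fun n => by
    rw [map_add, Units.smul_def, map_zsmul, coeff_mul, coeff_mul, coeff_mapSeq, coeff_mul,
      Finset.smul_sum, ← Finset.sum_add_distrib, map_sum]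
    exact Finset.sum_congr rfl fun p _ => A.leibniz _ (hx p.1)
  nilpotent := by
    obtain ⟨N, hN⟩ := A.nilpotent
    refine ⟨N, ?_⟩
    have h1 : ∀ m, ∀ x ∈ power K (SeqCarrier A) m, ∀ n, coeff A n x ∈ power K A m := by
      intro m
      induction m with
      | zero => exact fun _ _ _ => trivial
      | succ m ih =>
        intro x hx n
        refine (Submodule.span_le (p := (power K A (m + 1)).comap (coeff A n))).2 ?_ hx
        rintro _ ⟨y, z, hz, rfl⟩
        change coeff A n (y * z) ∈ power K A (m + 1)
        rw [coeff_mul]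
        exact Submodule.sum_mem _ fun p _ => mul_mem_power_succ _ (ih z hz p.2)
    refine eq_bot_iff.2 fun x hx => seq_ext fun n => ?_
    have h2 := h1 N x hx n
    rwa [hN, Submodule.mem_bot] at h2

variable (A) in
/-- The coefficients of an element of the algebra `seq A`. -/
noncomputable def seqCoeff (n : ℕ) : seq A →ₗ[K] A := coeff A n

theorem seqCoeff_mul (n : ℕ) (x y : seq A) :
    seqCoeff A n (x * y) =
      ∑ p ∈ Finset.HasAntidiagonal.antidiagonal n, seqCoeff A p.1 x * seqCoeff A p.2 y := rfl

@[simp] theorem seqCoeff_d (n : ℕ) (x : seq A) :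
    seqCoeff A n ((seq A).d x) = A.d (seqCoeff A n x) := rfl

theorem seqCoeff_mem_gr {i : ℤ} {x : seq A} (h : x ∈ (seq A).gr i) (n : ℕ) :
    seqCoeff A n x ∈ A.gr i := h n

theorem seqCoeff_mem (n : ℕ) (x : seq A) : seqCoeff A n x ∈ power K A (n - 1) := coeff_mem n x

theorem seqCoeff_ext {x y : seq A} (h : ∀ n, seqCoeff A n x = seqCoeff A n y) : x = y := seq_ext h

@[simp] theorem seqCoeff_sgn (n : ℕ) (x : seq A) :
    seqCoeff A n ((seq A).sgn x) = A.sgn (seqCoeff A n x) := by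
  induction x using (seq A).gr_induction with
  | hom i x hx =>
    rw [sgn_of_mem _ hx, sgn_of_mem _ (seqCoeff_mem_gr hx n), Units.smul_def, map_zsmul]
    rfl
  | add x y hx hy => simp only [map_add, hx, hy]

variable (A) in
/-- The derivative of polynomials, on the underlying vector space. -/
def seqCarrierDeriv : SeqCarrier A →ₗ[K] SeqCarrier A where
  toFun x := mkSeq (fun n => (n + 1) • coeff A (n + 1) x) fun n =>
    Submodule.smul_of_tower_mem _ (n + 1)
      (power_antitone A (by omega : n - 1 ≤ n + 1 - 1) (coeff_mem (n + 1) x))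
  map_add' x y := seq_ext fun n => by simp
  map_smul' r x := seq_ext fun n => by simp only [map_smul, coeff_mkSeq, smul_comm r, RingHom.id_apply]

variable (A) in
/-- The derivative of polynomials. -/
noncomputable def seqDeriv : seq A →ₗ[K] seq A := seqCarrierDeriv A

@[simp] theorem seqCoeff_seqDeriv (n : ℕ) (x : seq A) :
    seqCoeff A n (seqDeriv A x) = (n + 1) • seqCoeff A (n + 1) x := rfl

theorem seqDeriv_d (x : seq A) : seqDeriv A ((seq A).d x) = (seq A).d (seqDeriv A x) :=
  seqCoeff_ext fun n => by simp

theorem seqDeriv_mul (x y : seq A) :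
    seqDeriv A (x * y) = seqDeriv A x * y + x * seqDeriv A y := by
  refine seqCoeff_ext fun n => ?_
  -- The weight `n + 1 = i + j` is split in two; in each part the term of weight zero drops out and
  -- the index shifts.
  have h1 := Finset.Nat.sum_antidiagonal_succ (n := n)
    (f := fun p => p.1 • (seqCoeff A p.1 x * seqCoeff A p.2 y))
  have h2 := Finset.Nat.sum_antidiagonal_succ' (n := n)
    (f := fun p => p.2 • (seqCoeff A p.1 x * seqCoeff A p.2 y))
  rw [zero_smul, zero_add] at h1 h2
  rw [map_add, seqCoeff_seqDeriv, seqCoeff_mul, seqCoeff_mul, seqCoeff_mul]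
  simp only [seqCoeff_seqDeriv, smul_mul_assoc, mul_smul_comm]
  rw [← h1, ← h2, ← Finset.sum_add_distrib, Finset.smul_sum]
  refine Finset.sum_congr rfl fun p hp => ?_
  rw [← add_smul, Finset.HasAntidiagonal.mem_antidiagonal.1 hp]

theorem seqDeriv_mem {i : ℤ} {x : seq A} (h : x ∈ (seq A).gr i) :
    seqDeriv A x ∈ (seq A).gr i :=
  fun n => Submodule.smul_of_tower_mem (A.gr i) (n + 1) (h (n + 1))

end Seq

/-! ### Polynomial differential forms -/

section Path

variable (A : NilpDGA K)

/-- The differential `d(a + b dt) = d a + (d b + sgn a') dt`. -/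
noncomputable def formsD : OddCarrier (seq A) →ₗ[K] OddCarrier (seq A) :=
  LinearMap.prod ((seq A).d ∘ₗ oddFst (seq A))
    ((seq A).d ∘ₗ oddSnd (seq A) + (seq A).sgn ∘ₗ seqDeriv A ∘ₗ oddFst (seq A))

variable {A} in
@[simp] theorem oddFst_formsD (x : OddCarrier (seq A)) :
    oddFst (seq A) (formsD A x) = (seq A).d (oddFst (seq A) x) := rfl

variable {A} in
@[simp] theorem oddSnd_formsD (x : OddCarrier (seq A)) : oddSnd (seq A) (formsD A x) =
    (seq A).d (oddSnd (seq A) x) + (seq A).sgn (seqDeriv A (oddFst (seq A) x)) := rfl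

/-- The polynomial differential forms `a + b dt` on the line with coefficients in `A`. -/
noncomputable def forms : NilpDGA K :=
  oddExt (seq A) 1 odd_one (formsD A)
    (fun {i x} hx => by
      have h1 : (seq A).d (oddSnd (seq A) x) ∈ (seq A).gr (i - 1 + 1) := (seq A).d_mem hx.2
      have h2 : (seq A).sgn (seqDeriv A (oddFst (seq A) x)) ∈ (seq A).gr i :=
        (seq A).sgn_mem (seqDeriv_mem hx.1)
      rw [sub_add_cancel] at h1
      refine ⟨(seq A).d_mem hx.1, ?_⟩
      change _ ∈ (seq A).gr (i + 1 - 1)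
      rw [add_sub_cancel_right]
      exact add_mem h1 h2)
    (fun x => odd_ext (by simp [(seq A).d_d]) (by simp [(seq A).d_d, seqDeriv_d, (seq A).sgn_d]))
    (fun x y => odd_ext
      (by simp [(seq A).d_mul])
      (by
        simp [(seq A).d_mul, (seq A).sgn_d, (seq A).sgn_mul, seqDeriv_mul]
        noncomm_ring))

/-- The coefficient of `t ^ n`. -/
noncomputable def formsFst (n : ℕ) : forms A →ₗ[K] A := seqCoeff A n ∘ₗ oddFst (seq A)

/-- The coefficient of `t ^ n dt`. -/
noncomputable def formsSnd (n : ℕ) : forms A →ₗ[K] A := seqCoeff A n ∘ₗ oddSnd (seq A)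

variable {A}

theorem formsFst_mem (n : ℕ) (x : forms A) : formsFst A n x ∈ power K A (n - 1) :=
  seqCoeff_mem n _

theorem forms_ext {x y : forms A} (h1 : ∀ n, formsFst A n x = formsFst A n y)
    (h2 : ∀ n, formsSnd A n x = formsSnd A n y) : x = y :=
  odd_ext (seqCoeff_ext h1) (seqCoeff_ext h2)

theorem exists_forms (f g : ℕ → A) (hf : ∀ n, f n ∈ power K A (n - 1))
    (hg : ∀ n, g n ∈ power K A (n - 1)) :
    ∃ x : forms A, (∀ n, formsFst A n x = f n) ∧ ∀ n, formsSnd A n x = g n :=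
  ⟨odd (A := seq A) (mkSeq f hf) (mkSeq g hg), fun _ => rfl, fun _ => rfl⟩

theorem formsFst_mul (n : ℕ) (x y : forms A) : formsFst A n (x * y) =
    ∑ p ∈ Finset.HasAntidiagonal.antidiagonal n, formsFst A p.1 x * formsFst A p.2 y := rfl

theorem formsSnd_mul (n : ℕ) (x y : forms A) : formsSnd A n (x * y) =
    ∑ p ∈ Finset.HasAntidiagonal.antidiagonal n, formsFst A p.1 x * formsSnd A p.2 y +
    ∑ p ∈ Finset.HasAntidiagonal.antidiagonal n, formsSnd A p.1 x * A.sgn (formsFst A p.2 y) := by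
  refine (map_add (seqCoeff A n) _ _).trans ?_
  rw [seqCoeff_mul, seqCoeff_mul]
  simp only [seqCoeff_sgn]
  rfl

@[simp] theorem formsSnd_d (n : ℕ) (x : forms A) : formsSnd A n ((forms A).d x) =
    A.d (formsSnd A n x) + A.sgn ((n + 1) • formsFst A (n + 1) x) := by
  change seqCoeff A n ((seq A).d (oddSnd (seq A) x) +
    (seq A).sgn (seqDeriv A (oddFst (seq A) x))) = _
  rw [map_add, seqCoeff_sgn, seqCoeff_seqDeriv, seqCoeff_d]
  rfl

theorem formsFst_mem_gr {i : ℤ} {x : forms A} (h : x ∈ (forms A).gr i) (n : ℕ) :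
    formsFst A n x ∈ A.gr i := h.1 n

theorem formsSnd_mem_gr {i : ℤ} {x : forms A} (h : x ∈ (forms A).gr i) (n : ℕ) :
    formsSnd A n x ∈ A.gr (i - 1) := h.2 n

theorem formsFst_proj (i : ℤ) (n : ℕ) (x : forms A) :
    formsFst A n ((forms A).proj i x) = A.proj i (formsFst A n x) := by
  have h := map_proj (formsFst A n) 0
    (fun i a ha => by rw [add_zero]; exact formsFst_mem_gr ha n) i x
  rwa [add_zero] at h

theorem formsSnd_proj (i : ℤ) (n : ℕ) (x : forms A) :
    formsSnd A n ((forms A).proj i x) = A.proj (i - 1) (formsSnd A n x) :=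
  map_proj (formsSnd A n) (-1) (fun _ _ ha => formsSnd_mem_gr ha n) i x

end Path

/-! ### The path object and its filtration -/

section Path

variable (A : NilpDGA K)

/-- The forms `a + b dt` for which the coefficient of `t ^ n dt` belongs to `A ^ (n + 1)`. -/
noncomputable def pathSubmodule : Submodule K (forms A) where
  carrier := {x | ∀ n, formsSnd A n x ∈ power K A n}
  add_mem' hx hy n := by
    rw [map_add]
    exact add_mem (hx n) (hy n)
  zero_mem' n := by
    rw [map_zero]
    exact zero_mem _
  smul_mem' r x hx n := by
    rw [map_smul]
    exact Submodule.smul_mem _ r (hx n)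

/-- The bound is the one that derivatives satisfy: the coefficient of `t ^ (n + 1)` and that of `t ^
n dt` both range over `power K A n`. In `forms A` the latter may be larger, and integration would
leave the algebra. -/
theorem isDGSub_pathSubmodule : IsDGSub (forms A) (pathSubmodule A) := by
  refine ⟨fun i x hx n => ?_, fun x hx n => ?_, fun x hx y hy n => ?_⟩
  · rw [formsSnd_proj]
    exact (A.isDGIdeal_power n).proj_mem _ _ (hx n)
  · rw [formsSnd_d]
    exact add_mem ((A.isDGIdeal_power n).d_mem _ (hx n))
      (A.sgn_mem_power (Submodule.smul_of_tower_mem _ _ (formsFst_mem (n + 1) x)))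
  · rw [formsSnd_mul]
    refine add_mem (Submodule.sum_mem _ fun p hp => ?_) (Submodule.sum_mem _ fun p hp => ?_)
    all_goals rw [Finset.HasAntidiagonal.mem_antidiagonal] at hp
    · exact power_antitone A (by omega) (A.mul_mem_power (formsFst_mem p.1 x) (hy p.2))
    · exact power_antitone A (by omega)
        (A.mul_mem_power (hx p.1) (A.sgn_mem_power (formsFst_mem p.2 y)))

/-- The path object of `A`. -/
noncomputable def path : NilpDGA K := sub (isDGSub_pathSubmodule A)

/-- The inclusion of the path object in the algebra of forms. -/
noncomputable def pathIncl : path A ⟶ forms A := incl (isDGSub_pathSubmodule A)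

/-- The coefficient of `t ^ n`. -/
noncomputable def pathFst (n : ℕ) : path A →ₗ[K] A :=
  formsFst A n ∘ₗ (app (pathIncl A) : path A →ₗ[K] forms A)

/-- The coefficient of `t ^ n dt`. -/
noncomputable def pathSnd (n : ℕ) : path A →ₗ[K] A :=
  formsSnd A n ∘ₗ (app (pathIncl A) : path A →ₗ[K] forms A)

variable {A}

theorem pathFst_mem (n : ℕ) (x : path A) : pathFst A n x ∈ power K A (n - 1) := formsFst_mem n _

theorem pathSnd_mem (n : ℕ) (x : path A) : pathSnd A n x ∈ power K A n :=
  incl_mem (isDGSub_pathSubmodule A) x n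

theorem path_ext {x y : path A} (h1 : ∀ n, pathFst A n x = pathFst A n y)
    (h2 : ∀ n, pathSnd A n x = pathSnd A n y) : x = y :=
  incl_injective (isDGSub_pathSubmodule A) (forms_ext h1 h2)

theorem exists_path (f g : ℕ → A) (hf : ∀ n, f n ∈ power K A (n - 1))
    (hg : ∀ n, g n ∈ power K A n) :
    ∃ x : path A, (∀ n, pathFst A n x = f n) ∧ ∀ n, pathSnd A n x = g n := by
  obtain ⟨x, hx, hx'⟩ := exists_forms f g hf fun n => power_antitone A (Nat.sub_le n 1) (hg n)
  have hx2 : x ∈ pathSubmodule A := fun n => by rw [hx' n]; exact hg n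
  obtain ⟨x, rfl⟩ := exists_incl_eq (isDGSub_pathSubmodule A) hx2
  exact ⟨x, hx, hx'⟩

theorem pathFst_mul (n : ℕ) (x y : path A) : pathFst A n (x * y) =
    ∑ p ∈ Finset.HasAntidiagonal.antidiagonal n, pathFst A p.1 x * pathFst A p.2 y :=
  formsFst_mul n _ _

theorem pathSnd_mul (n : ℕ) (x y : path A) : pathSnd A n (x * y) =
    ∑ p ∈ Finset.HasAntidiagonal.antidiagonal n, pathFst A p.1 x * pathSnd A p.2 y +
    ∑ p ∈ Finset.HasAntidiagonal.antidiagonal n, pathSnd A p.1 x * A.sgn (pathFst A p.2 y) :=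
  formsSnd_mul n _ _

@[simp] theorem pathFst_d (n : ℕ) (x : path A) :
    pathFst A n ((path A).d x) = A.d (pathFst A n x) := rfl

@[simp] theorem pathSnd_d (n : ℕ) (x : path A) : pathSnd A n ((path A).d x) =
    A.d (pathSnd A n x) + A.sgn ((n + 1) • pathFst A (n + 1) x) := formsSnd_d n _

theorem pathFst_mem_gr {i : ℤ} {x : path A} (h : x ∈ (path A).gr i) (n : ℕ) :
    pathFst A n x ∈ A.gr i := formsFst_mem_gr (app_gr (pathIncl A) h) n

theorem mem_path_gr {i : ℤ} {x : path A} (h1 : ∀ n, pathFst A n x ∈ A.gr i)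
    (h2 : ∀ n, pathSnd A n x ∈ A.gr (i - 1)) : x ∈ (path A).gr i := ⟨h1, h2⟩

theorem pathFst_proj (i : ℤ) (n : ℕ) (x : path A) :
    pathFst A n ((path A).proj i x) = A.proj i (pathFst A n x) := by
  have h := congrArg (formsFst A n) (app_proj (pathIncl A) i x)
  rwa [formsFst_proj] at h

theorem pathSnd_proj (i : ℤ) (n : ℕ) (x : path A) :
    pathSnd A n ((path A).proj i x) = A.proj (i - 1) (pathSnd A n x) := by
  have h := congrArg (formsSnd A n) (app_proj (pathIncl A) i x)
  rwa [formsSnd_proj] at h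

variable (A) in
/-- Evaluation of paths at `t = 0`. -/
noncomputable def evalZero : path A ⟶ A :=
  Hom.mk
    { toFun := pathFst A 0
      map_smul' := fun r x => map_smul (pathFst A 0) r x
      map_zero' := map_zero (pathFst A 0)
      map_add' := map_add (pathFst A 0)
      map_mul' := fun x y => by simp [pathFst_mul] }
    (fun hx => pathFst_mem_gr hx 0) (fun _ => rfl)

theorem app_evalZero (x : path A) : app (evalZero A) x = pathFst A 0 x := rfl

/-- The product of the two sums has extra terms, of total degree at least `N + 2`; they lie in a
power of `A` that is zero. -/
theorem sum_pathFst_mul {N : ℕ} (hN : power K A N = ⊥) (x y : path A) :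
    ∑ n ∈ Finset.range (N + 2), pathFst A n (x * y) =
      (∑ n ∈ Finset.range (N + 2), pathFst A n x) * ∑ n ∈ Finset.range (N + 2), pathFst A n y := by
  have h1 : ∀ n, pathFst A n (x * y) =
      ∑ k ∈ Finset.range (n + 1), pathFst A k x * pathFst A (n - k) y := fun n => by
    rw [pathFst_mul, Finset.Nat.sum_antidiagonal_eq_sum_range_succ
      (fun i j => pathFst A i x * pathFst A j y)]
  simp only [h1]
  rw [Finset.sum_range_diag_flip (N + 2) fun i j => pathFst A i x * pathFst A j y,
    Finset.sum_mul]
  refine Finset.sum_congr rfl fun m hm => ?_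
  rw [Finset.mul_sum]
  refine Finset.sum_subset (Finset.range_mono (Nat.sub_le _ _)) fun k hk hk' => ?_
  rw [Finset.mem_range] at hm hk hk'
  have h2 := power_antitone A (show N ≤ m - 1 + (k - 1) + 1 by omega)
    (A.mul_mem_power (pathFst_mem m x) (pathFst_mem k y))
  rwa [hN, Submodule.mem_bot] at h2

variable (A) in
/-- The sum of the first `N` coefficients, as a linear map. -/
noncomputable def sumPathFst (N : ℕ) : path A →ₗ[K] A := ∑ n ∈ Finset.range N, pathFst A n

theorem sumPathFst_apply (N : ℕ) (x : path A) :
    sumPathFst A N x = ∑ n ∈ Finset.range N, pathFst A n x := by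
  rw [sumPathFst, LinearMap.sum_apply]

/-- Evaluation of paths at `t = 1`. -/
noncomputable def evalOne {N : ℕ} (hN : power K A N = ⊥) : path A ⟶ A :=
  Hom.mk
    { toFun := sumPathFst A (N + 2)
      map_smul' := fun r x => map_smul (sumPathFst A (N + 2)) r x
      map_zero' := map_zero (sumPathFst A (N + 2))
      map_add' := map_add (sumPathFst A (N + 2))
      map_mul' := fun x y => by simp only [sumPathFst_apply, sum_pathFst_mul hN] }
    (fun {i x} hx => by
      change sumPathFst A (N + 2) x ∈ A.gr i
      rw [sumPathFst_apply]
      exact Submodule.sum_mem _ fun n _ => pathFst_mem_gr hx n)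
    (fun x => by
      change sumPathFst A (N + 2) ((path A).d x) = A.d (sumPathFst A (N + 2) x)
      simp only [sumPathFst_apply, map_sum, pathFst_d])

theorem app_evalOne {N : ℕ} (hN : power K A N = ⊥) (x : path A) :
    app (evalOne hN) x = ∑ n ∈ Finset.range (N + 2), pathFst A n x := sumPathFst_apply _ x

theorem exists_eval_eq {N : ℕ} (hN : power K A N = ⊥) (a b : A) :
    ∃ x : path A, app (evalZero A) x = a ∧ app (evalOne hN) x = b := by
  -- The segment `a + (b - a) t`: coefficients of index `0` and `1` are unrestricted, since `power K
  -- A 0` is `A`.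
  obtain ⟨x, hx, -⟩ := exists_path (fun n => if n = 0 then a else if n = 1 then b - a else 0) 0
    (fun n => by
      split_ifs with h0 h1
      · rw [h0]; trivial
      · rw [h1]; trivial
      · exact zero_mem _) fun n => zero_mem _
  refine ⟨x, hx 0, ?_⟩
  -- The range `N + 2` contains both indices `0` and `1` even when `N = 0`.
  rw [app_evalOne, Finset.sum_range_succ', Finset.sum_range_succ', Finset.sum_eq_zero]
  · rw [hx, hx]
    simp
  · intro n _
    rw [hx]
    simp

variable (A) in
theorem exists_constPath : ∃ c : A ⟶ path A,
    (∀ a, pathFst A 0 (app c a) = a) ∧ ∀ n a, pathFst A (n + 1) (app c a) = 0 := by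
  have h := fun a : A => exists_path (fun n => if n = 0 then a else 0) 0
    (fun n => by
      split_ifs with h0
      · rw [h0]; trivial
      · exact zero_mem _) fun n => zero_mem _
  choose c hc hc' using h
  have hc0 : ∀ a, pathFst A 0 (c a) = a := fun a => hc a 0
  have hc1 : ∀ n a, pathFst A (n + 1) (c a) = 0 := fun n a => hc a (n + 1)
  have hext : ∀ a x, pathFst A 0 x = a → (∀ n, pathFst A (n + 1) x = 0) →
      (∀ n, pathSnd A n x = 0) → c a = x := fun a x h0 h1 h2 => path_ext
    (fun n => by
      cases n with
      | zero => rw [hc0, h0]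
      | succ n => rw [hc1, h1])
    (fun n => (hc' a n).trans (h2 n).symm)
  refine ⟨Hom.mk
    { toFun := c
      map_smul' := fun r a => hext _ _ (by simp [hc0]) (fun n => by simp [hc1])
        fun n => by simp [hc']
      map_zero' := hext _ _ (by simp) (fun n => by simp) fun n => by simp
      map_add' := fun a b => hext _ _ (by simp [hc0]) (fun n => by simp [hc1])
        fun n => by simp [hc']
      map_mul' := fun a b => hext _ _ (by simp [pathFst_mul, hc0])
        (fun n => by
          rw [pathFst_mul]
          refine Finset.sum_eq_zero fun p hp => ?_
          rw [Finset.HasAntidiagonal.mem_antidiagonal] at hp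
          obtain ⟨i, j⟩ := p
          cases i with
          | succ i => rw [hc1, zero_mul]
          | zero =>
            cases j with
            | succ j => rw [hc1, mul_zero]
            | zero => exact absurd hp (by simp))
        fun n => by simp [pathSnd_mul, hc'] }
    (fun {i a} ha => ?_) (fun a => ?_), hc0, hc1⟩
  · refine mem_path_gr (fun n => ?_) fun n => ?_
    · cases n with
      | zero => exact (hc0 a).symm ▸ ha
      | succ n => exact (hc1 n a).symm ▸ zero_mem _
    · exact (hc' a n).symm ▸ zero_mem _
  · exact hext _ _ (by change pathFst A 0 ((path A).d (c a)) = _; simp [hc0])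
      (fun n => by change pathFst A _ ((path A).d (c a)) = _; simp [hc1])
      fun n => by change pathSnd A _ ((path A).d (c a)) = _; simp [hc', hc1]

variable (A) in
/-- The filtration of the kernel of the evaluation at `0`. -/
noncomputable def pathIdeal (k : ℕ) : Submodule K (path A) where
  carrier := {x | pathFst A 0 x = 0 ∧ (∀ n, pathFst A (n + 1) x ∈ power K A (max n k)) ∧
    ∀ n, pathSnd A n x ∈ power K A (max n k)}
  add_mem' {x y} hx hy := by
    refine ⟨?_, fun n => ?_, fun n => ?_⟩
    · rw [map_add, hx.1, hy.1, add_zero]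
    · rw [map_add]
      exact add_mem (hx.2.1 n) (hy.2.1 n)
    · rw [map_add]
      exact add_mem (hx.2.2 n) (hy.2.2 n)
  zero_mem' := by
    refine ⟨map_zero _, fun n => ?_, fun n => ?_⟩ <;> rw [map_zero] <;> exact zero_mem _
  smul_mem' r x hx := by
    refine ⟨?_, fun n => ?_, fun n => ?_⟩
    · rw [map_smul, hx.1, smul_zero]
    · rw [map_smul]
      exact Submodule.smul_mem _ r (hx.2.1 n)
    · rw [map_smul]
      exact Submodule.smul_mem _ r (hx.2.2 n)

theorem pathIdeal_succ_le (k : ℕ) : pathIdeal A (k + 1) ≤ pathIdeal A k := fun _ hx =>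
  ⟨hx.1, fun n => power_antitone A (by omega) (hx.2.1 n),
    fun n => power_antitone A (by omega) (hx.2.2 n)⟩

/-- The coefficient of `t ^ i` in `a` raises the exponent by at least `max i 1`, and that of `t ^ i
dt` by `i + 1`. So both bounds `n` and `k + 1` are reached. -/
theorem mul_mem_pathIdeal (k : ℕ) (a : path A) {x : path A} (hx : x ∈ pathIdeal A k) :
    a * x ∈ pathIdeal A (k + 1) := by
  obtain ⟨h0, h1, h2⟩ := hx
  refine ⟨?_, fun n => ?_, fun n => ?_⟩
  · simp [pathFst_mul, h0]
  · rw [pathFst_mul]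
    refine Submodule.sum_mem _ fun p hp => ?_
    rw [Finset.HasAntidiagonal.mem_antidiagonal] at hp
    obtain ⟨i, j⟩ := p
    cases j with
    | zero => simp [h0]
    | succ j =>
      have h := A.mul_mem_power (pathFst_mem i a) (h1 j)
      exact power_antitone A (by dsimp only at hp; omega) h
  · rw [pathSnd_mul]
    refine add_mem (Submodule.sum_mem _ fun p hp => ?_) (Submodule.sum_mem _ fun p hp => ?_)
    all_goals rw [Finset.HasAntidiagonal.mem_antidiagonal] at hp
    · exact power_antitone A (by omega) (A.mul_mem_power (pathFst_mem p.1 a) (h2 p.2))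
    · obtain ⟨i, j⟩ := p
      cases j with
      | zero => simp [h0]
      | succ j =>
        have h := A.mul_mem_power (pathSnd_mem i a) (A.sgn_mem_power (h1 j))
        exact power_antitone A (by dsimp only at hp; omega) h

theorem isDGIdeal_pathIdeal (k : ℕ) : IsDGIdeal (path A) (pathIdeal A k) := by
  refine IsDGIdeal.of_left (fun i x hx => ⟨?_, fun n => ?_, fun n => ?_⟩)
    (fun x hx => ⟨?_, fun n => ?_, fun n => ?_⟩)
    fun a x hx => pathIdeal_succ_le k (mul_mem_pathIdeal k a hx)
  · rw [pathFst_proj, hx.1, map_zero]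
  · rw [pathFst_proj]
    exact (A.isDGIdeal_power _).proj_mem _ _ (hx.2.1 n)
  · rw [pathSnd_proj]
    exact (A.isDGIdeal_power _).proj_mem _ _ (hx.2.2 n)
  · rw [pathFst_d, hx.1, map_zero]
  · rw [pathFst_d]
    exact (A.isDGIdeal_power _).d_mem _ (hx.2.1 n)
  · rw [pathSnd_d]
    exact add_mem ((A.isDGIdeal_power _).d_mem _ (hx.2.2 n))
      (A.sgn_mem_power (Submodule.smul_of_tower_mem _ _ (hx.2.1 n)))

theorem mem_pathIdeal_zero {x : path A} : x ∈ pathIdeal A 0 ↔ pathFst A 0 x = 0 := by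
  refine ⟨fun hx => hx.1, fun hx => ⟨hx, fun n => ?_, fun n => ?_⟩⟩
  · rw [Nat.max_zero]
    exact pathFst_mem (n + 1) x
  · rw [Nat.max_zero]
    exact pathSnd_mem n x

theorem pathIdeal_eq_bot {N : ℕ} (hN : power K A N = ⊥) : pathIdeal A N = ⊥ := by
  have h : ∀ n, ∀ a ∈ power K A (max n N), a = 0 := fun n a ha => by
    have h1 := power_antitone A (le_max_right n N) ha
    rwa [hN, Submodule.mem_bot] at h1
  refine eq_bot_iff.2 fun x hx => path_ext (fun n => ?_) fun n => ?_
  · rw [map_zero]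
    cases n with
    | zero => exact hx.1
    | succ n => exact h n _ (hx.2.1 n)
  · rw [map_zero]
    exact h n _ (hx.2.2 n)

/-- The contraction is integration from `0` to `t`, up to sign. It stays in the filtration, since `t
^ n dt` and `t ^ (n + 1)` carry the same bound; dividing by `n + 1` needs characteristic zero. -/
theorem pathIdeal_acyclic [CharZero K] (k : ℕ) {x : path A} (hx : x ∈ pathIdeal A k)
    (hdx : (path A).d x ∈ pathIdeal A (k + 1)) :
    ∃ y ∈ pathIdeal A k, x - (path A).d y ∈ pathIdeal A (k + 1) := by
  obtain ⟨y, hy, hy'⟩ := exists_path (A := A)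
    -- For `n = 0` the convention `0⁻¹ = 0` gives the primitive with zero constant term.
    (fun n => ((n : K)⁻¹) • A.sgn (pathSnd A (n - 1) x)) 0
    (fun n => Submodule.smul_mem _ _ (A.sgn_mem_power (pathSnd_mem _ x))) fun n => zero_mem _
  have hy1 : ∀ n, (n + 1) • pathFst A (n + 1) y = A.sgn (pathSnd A n x) := fun n => by
    rw [hy, ← Nat.cast_smul_eq_nsmul K, smul_smul,
      mul_inv_cancel₀ (Nat.cast_ne_zero.2 n.succ_ne_zero), one_smul]
    rfl
  have hy0 : pathFst A 0 y = 0 := by rw [hy]; simp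
  refine ⟨y, ⟨hy0, fun n => ?_, fun n => ?_⟩, ?_, fun n => ?_, fun n => ?_⟩
  · rw [hy]
    exact Submodule.smul_mem _ _ (A.sgn_mem_power (hx.2.2 n))
  · rw [hy']
    exact zero_mem _
  · rw [map_sub, pathFst_d, hx.1, hy0, map_zero, sub_zero]
  -- After `sgn`, the `dt`-part of `hdx` is `n + 1` times the required difference.
  · have h1 := A.sgn_mem_power (hdx.2.2 n)
    rw [pathSnd_d, map_add, sgn_sgn, sgn_d, ← hy1, map_nsmul, neg_add_eq_sub, ← nsmul_sub,
      ← Nat.cast_smul_eq_nsmul K] at h1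
    have h2 := Submodule.smul_mem _ ((n + 1 : ℕ) : K)⁻¹ h1
    rwa [smul_smul, inv_mul_cancel₀ (Nat.cast_ne_zero.2 n.succ_ne_zero), one_smul] at h2
  · rw [map_sub, pathSnd_d, hy1, hy', sgn_sgn]
    simp

end Path

end NilpDGA

/-! ### Bijectivity from complexes to all algebras -/

namespace IsPredeformation

variable {F G : NilpDGA K ⥤ Type v}

/-- A morphism of predeformation functors which is bijective on complexes is bijective. -/
theorem bijective_app [CharZero K] (hF : IsPredeformation F) (hG : IsPredeformation G) (θ : F ⟶ G)
    (hθ : ∀ A : NilpDGA K, A.IsComplex → Function.Bijective (θ.app A)) (A : NilpDGA K) :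
    Function.Bijective (θ.app A) := by
  refine ⟨fun x y hxy => ?_, fun y => ?_⟩
  · obtain ⟨N, hN⟩ := A.nilpotent
    obtain ⟨c, hc0, hc1⟩ := exists_constPath A
    have h0 : c ≫ evalZero A = 𝟙 A := hom_ext fun a => hc0 a
    have h1 : c ≫ evalOne hN = 𝟙 A := hom_ext fun a => by
      rw [app_comp, app_evalOne, Finset.sum_range_succ', hc0]
      simp [hc1]
    let l : path A ⟶ prod A A := lift _ _ (evalZero A) (evalOne hN) rfl
    have hl0 : l ≫ fst _ _ = evalZero A := rfl
    have hl1 : l ≫ snd _ _ = evalOne hN := rfl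
    have hl : Function.Surjective (app l) := fun x => by
      obtain ⟨p, hp0, hp1⟩ := exists_eval_eq hN x.1.1 x.1.2
      exact ⟨p, Subtype.ext (Prod.ext hp0 hp1)⟩
    obtain ⟨hxy0, hxy1⟩ := hF.pair_spec (A := A) (B := A) x y
    -- The constant path at `θ x` has endpoints `θ x` and `θ y`, so it lifts to a path in `F` from
    -- `x` to `y`.
    obtain ⟨p, hp, hp'⟩ := exists_lift hF hG θ hθ hl (hF.pair (A := A) (B := A) x y)
      (G.map c (θ.app A x)) (by
        refine hG.prod_ext ?_ ?_
        · rw [← NatTrans.naturality_apply, hxy0, ← Functor.map_comp_apply, ← Functor.map_comp_apply,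
            hl0, h0, Functor.map_id_apply]
        · rw [← NatTrans.naturality_apply, hxy1, ← Functor.map_comp_apply, ← Functor.map_comp_apply,
            hl1, h1, Functor.map_id_apply, hxy])
    have hp0 : F.map (evalZero A) p = x := by
      rw [← hxy0, ← hp', ← Functor.map_comp_apply, hl0]
    have hp1 : F.map (evalOne hN) p = y := by
      rw [← hxy1, ← hp', ← Functor.map_comp_apply, hl1]
    -- Modulo the kernel of evaluation at `0`, a path equals the constant path at its origin. Hence
    -- `p` and the constant path at `x` agree at the bottom of the filtration.
    have hq : evalZero A ≫ c ≫ quotMk (isDGIdeal_pathIdeal 0) =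
        quotMk (isDGIdeal_pathIdeal (A := A) 0) := hom_ext fun z => by
      rw [app_comp, app_comp, ← sub_eq_zero, ← map_sub, quotMk_eq_zero, mem_pathIdeal_zero, map_sub,
        hc0, app_evalZero, sub_self]
    have hpc : p = F.map c x := by
      refine ext_of_filtration hF hG θ hθ (pathIdeal A) isDGIdeal_pathIdeal pathIdeal_succ_le
        (fun k a z hz => mul_mem_pathIdeal k a hz) (fun k z hz hdz => pathIdeal_acyclic k hz hdz)
        (pathIdeal_eq_bot hN) ?_ ?_
      · rw [← hq, Functor.map_comp_apply, Functor.map_comp_apply, hp0, hq,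
          ← Functor.map_comp_apply]
      · rw [hp, NatTrans.naturality_apply]
    rw [← hp1, hpc, ← Functor.map_comp_apply, h1, Functor.map_id_apply]
  · obtain ⟨x, hx, -⟩ := exists_lift hF hG θ hθ (f := zeroHom A (NilpDGA.zero K))
      (fun _ => ⟨0, rfl⟩) hF.zero.some.default y (hG.zero_ext _ _)
    exact ⟨x, hx⟩

theorem bijective_prod (hF : IsPredeformation F) (hG : IsPredeformation G) (θ : F ⟶ G)
    {A B : NilpDGA K} (hA : Function.Bijective (θ.app A)) (hB : Function.Bijective (θ.app B)) :
    Function.Bijective (θ.app (prod A B)) := by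
  refine ⟨fun x y hxy => hF.prod_ext (hA.1 ?_) (hB.1 ?_), fun z => ?_⟩
  · rw [NatTrans.naturality_apply, NatTrans.naturality_apply, hxy]
  · rw [NatTrans.naturality_apply, NatTrans.naturality_apply, hxy]
  · obtain ⟨a, ha⟩ := hA.2 (G.map (fst _ _) z)
    obtain ⟨b, hb⟩ := hB.2 (G.map (snd _ _) z)
    obtain ⟨h1, h2⟩ := hF.pair_spec a b
    refine ⟨hF.pair a b, hG.prod_ext ?_ ?_⟩
    · rw [← NatTrans.naturality_apply, h1, ha]
    · rw [← NatTrans.naturality_apply, h2, hb]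

end IsPredeformation

namespace IsDeformation

variable {F G : NilpDGA K ⥤ Type v}

theorem bijective_of_isAcyclicSmallExtension (hF : IsDeformation F) (hG : IsDeformation G)
    (θ : F ⟶ G) {A B : NilpDGA K} {f : A ⟶ B} (hf : IsAcyclicSmallExtension f)
    (hB : Function.Bijective (θ.app B)) : Function.Bijective (θ.app A) := by
  have h1 := hF.bijective_of_acyclic f hf
  have h2 := hG.bijective_of_acyclic f hf
  refine ⟨fun x y hxy => h1.1 (hB.1 ?_), fun z => ?_⟩
  · rw [NatTrans.naturality_apply, NatTrans.naturality_apply, hxy]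
  · obtain ⟨b, hb⟩ := hB.2 (G.map f z)
    obtain ⟨a, rfl⟩ := h1.2 b
    exact ⟨a, h2.1 (by rw [← NatTrans.naturality_apply, hb])⟩

end IsDeformation

/-! ### Reduction of complexes to lines -/

namespace NilpDGA

variable {A : NilpDGA K}

theorem isDGIdeal_span (hA : A.IsComplex) (s : Set A)
    (hs : ∀ a ∈ s, (∃ i, a ∈ A.gr i) ∧ A.d a ∈ Submodule.span K s) :
    IsDGIdeal A (Submodule.span K s) := by
  refine IsDGIdeal.of_left (fun i x hx => ?_) (fun x hx => ?_) fun a x _ => ?_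
  · refine (Submodule.span_le (p := (Submodule.span K s).comap (A.proj i))).2 (fun a ha => ?_) hx
    obtain ⟨⟨j, hj⟩, -⟩ := hs a ha
    change A.proj i a ∈ Submodule.span K s
    rw [A.proj_of_mem hj]
    split_ifs
    · exact Submodule.subset_span ha
    · exact zero_mem _
  · exact (Submodule.span_le (p := (Submodule.span K s).comap A.d)).2 (fun a ha => (hs a ha).2) hx
  · rw [hA]
    exact zero_mem _

theorem quot_isComplex (hA : A.IsComplex) {I : Submodule K A} (hI : IsDGIdeal A I) :
    (quot hI).IsComplex := by
  intro x y
  obtain ⟨x, rfl⟩ := quotMk_surjective _ x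
  obtain ⟨y, rfl⟩ := quotMk_surjective _ y
  rw [← map_mul, hA, map_zero]

theorem finrank_quot_lt {I : Submodule K A} (hI : IsDGIdeal A I) {a : A} (ha : a ∈ I)
    (h0 : a ≠ 0) : Module.finrank K (quot hI) < Module.finrank K A := by
  have h1 := I.finrank_quotient_add_finrank
  have h2 : 0 < Module.finrank K I := Module.finrank_pos_iff_exists_ne_zero.2
    ⟨⟨a, ha⟩, fun h => h0 (congrArg Subtype.val h)⟩
  change Module.finrank K (A ⧸ I) < _
  omega

/-- Killing a homogeneous element and its nonzero differential, in a complex, is an acyclic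
small extension. -/
theorem exists_acyclic_quot (hA : A.IsComplex) {i : ℤ} {a : A} (ha : a ∈ A.gr i) (hd : A.d a ≠ 0) :
    ∃ (I : Submodule K A) (hI : IsDGIdeal A I), a ∈ I ∧ IsAcyclicSmallExtension (quotMk hI) := by
  have hI : IsDGIdeal A (Submodule.span K {a, A.d a}) := by
    refine isDGIdeal_span hA _ ?_
    rintro _ (rfl | rfl)
    · exact ⟨⟨i, ha⟩, Submodule.subset_span (Or.inr rfl)⟩
    · exact ⟨⟨i + 1, A.d_mem ha⟩, by rw [A.d_d]; exact zero_mem _⟩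
  refine ⟨_, hI, Submodule.subset_span (Or.inl rfl), quotMk_surjective hI, fun b x _ => hA b x, ?_⟩
  -- For a cocycle `r a + s d a`, the condition `d a ≠ 0` forces `r = 0`, and `s d a` bounds `s a`.
  intro x hx hdx
  obtain ⟨r, s, rfl⟩ := Submodule.mem_span_pair.1 ((quotMk_eq_zero hI).1 hx)
  rw [map_add, map_smul, map_smul, A.d_d, smul_zero, add_zero, smul_eq_zero_iff_left hd] at hdx
  refine ⟨s • a, (quotMk_eq_zero hI).2 (Submodule.smul_mem _ s
    (Submodule.subset_span (Or.inl rfl))), ?_⟩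
  rw [map_smul, hdx, zero_smul, zero_add]

/-- A complex with zero differential is the sum of a line and its quotient by it. -/
theorem exists_bijective_prod_shift (hA : A.IsComplex) (hd : ∀ a, A.d a = 0) {i : ℤ} {a : A}
    (ha : a ∈ A.gr i) (h0 : a ≠ 0) :
    ∃ (I : Submodule K A) (hI : IsDGIdeal A I) (f : A ⟶ prod (shift K (-i)) (quot hI)), a ∈ I ∧
      Function.Bijective (app f) := by
  have hI : IsDGIdeal A (Submodule.span K {a}) := by
    refine isDGIdeal_span hA _ ?_
    rintro _ rfl
    exact ⟨⟨i, ha⟩, by rw [hd]; exact zero_mem _⟩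
  obtain ⟨φ, hφ⟩ : ∃ φ : A →ₗ[K] ShiftCarrier K, φ a = (1 : K) := by
    exact Module.Projective.exists_dual_eq_one K h0
  -- Any functional with value `1` at `a` will do once it is made homogeneous by the projection to
  -- degree `i`.
  let ψ : A →ₗ[K] ShiftCarrier K := φ ∘ₗ A.proj i
  let g : A ⟶ shift K (-i) := Hom.mk
    { toFun := ψ
      map_smul' := map_smul ψ
      map_zero' := map_zero ψ
      map_add' := map_add ψ
      map_mul' := fun x y => (congrArg ψ (hA x y)).trans (map_zero ψ) }
    (fun {j x} hx => by
      change φ (A.proj i x) ∈ (if j + -i = 0 then ⊤ else ⊥ : Submodule K (ShiftCarrier K))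
      split_ifs with h
      · trivial
      · rw [A.proj_of_mem hx, if_neg (by omega), map_zero]
        exact zero_mem _)
    (fun x => by
      change φ (A.proj i (A.d x)) = 0
      rw [hd, map_zero, map_zero])
  have hg : ∀ r : K, app g (r • a) = r := fun r => by
    change φ (A.proj i (r • a)) = r
    rw [map_smul, A.proj_of_mem ha, if_pos rfl, map_smul, hφ]
    exact mul_one r
  refine ⟨_, hI, lift _ _ g (quotMk hI) rfl, Submodule.mem_span_singleton_self a, ?_, ?_⟩
  · refine (injective_iff_map_eq_zero _).2 fun x hx => ?_
    have h1 : app g x = 0 := congrArg (fun y => y.1.1) hx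
    have h2 : app (quotMk hI) x = 0 := congrArg (fun y => y.1.2) hx
    obtain ⟨r, rfl⟩ := Submodule.mem_span_singleton.1 ((quotMk_eq_zero hI).1 h2)
    rw [hg] at h1
    exact h1 ▸ zero_smul K a
  · rintro ⟨⟨s, q⟩, -⟩
    obtain ⟨y, rfl⟩ := quotMk_surjective hI q
    let r : K := (s - app g y : ShiftCarrier K)
    refine ⟨y + r • a, Subtype.ext (Prod.ext ?_ ?_)⟩
    · change app g (y + _) = s
      rw [map_add, hg]
      exact add_sub_cancel _ _
    · change app (quotMk hI) (y + _) = _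
      rw [map_add, (quotMk_eq_zero hI).2 (Submodule.smul_mem _ _
        (Submodule.mem_span_singleton_self a)), add_zero]

end NilpDGA

/-! ### Deformation functors on complexes, and the theorem -/

namespace IsDeformation

variable {F G : NilpDGA K ⥤ Type v}

/-- A morphism of deformation functors which is bijective on the complexes `K[n]` is bijective
on all complexes. -/
theorem bijective_of_isComplex (hF : IsDeformation F) (hG : IsDeformation G) (θ : F ⟶ G)
    (hθ : ∀ n, Function.Bijective (θ.app (shift K n))) (A : NilpDGA K) (hA : A.IsComplex) :
    Function.Bijective (θ.app A) := by
  -- Induction on dimension: a nonzero differential is removed by an acyclic small extension; with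
  -- zero differential, a line splits off.
  induction hn : Module.finrank K A using Nat.strong_induction_on generalizing A with
  | _ n ih =>
    subst hn
    by_cases hd : ∀ i, ∀ a ∈ A.gr i, A.d a = 0
    · have hd' : ∀ a, A.d a = 0 := fun a =>
        (Submodule.mem_bot K).1 (A.map_mem_of_degree ⊥ A.d (fun i a ha => hd i a ha) a)
      by_cases h0 : ∀ i, ∀ a ∈ A.gr i, a = 0
      · have h0' : ∀ a : A, a = 0 := fun a =>
          (Submodule.mem_bot K).1 (A.map_mem_of_degree ⊥ LinearMap.id (fun i a ha => h0 i a ha) a)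
        refine bijective_of_isAcyclicSmallExtension hF hG θ (f := zeroHom A (NilpDGA.zero K))
          (isAcyclicSmallExtension_of_bijective _
            ⟨fun a b _ => (h0' a).trans (h0' b).symm, fun _ => ⟨0, rfl⟩⟩)
          ⟨fun _ _ _ => hF.zero_ext _ _, fun _ => ⟨hF.zero.some.default, hG.zero_ext _ _⟩⟩
      · push Not at h0
        obtain ⟨i, a, ha, ha0⟩ := h0
        obtain ⟨I, hI, f, haI, hf⟩ := exists_bijective_prod_shift hA hd' ha ha0
        exact bijective_of_isAcyclicSmallExtension hF hG θ (isAcyclicSmallExtension_of_bijective f hf)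
          (hF.bijective_prod hG.toIsPredeformation θ (hθ _)
            (ih _ (finrank_quot_lt hI haI ha0) _ (quot_isComplex hA hI) rfl))
    · push Not at hd
      obtain ⟨i, a, ha, hda⟩ := hd
      obtain ⟨I, hI, haI, hq⟩ := exists_acyclic_quot hA ha hda
      have ha0 : a ≠ 0 := fun h => hda (by rw [h, map_zero])
      exact bijective_of_isAcyclicSmallExtension hF hG θ hq
        (ih _ (finrank_quot_lt hI haI ha0) _ (quot_isComplex hA hI) rfl)

end IsDeformation

theorem isIso_iff_bijective_app {F G : NilpDGA K ⥤ Type v} (θ : F ⟶ G) :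
    IsIso θ ↔ ∀ A, Function.Bijective (θ.app A) := by
  simp only [NatTrans.isIso_iff_isIso_app, isIso_iff_bijective]

theorem IsDeformation.isIso_tangentMap_iff {F G : NilpDGA K ⥤ Type v} (hF : IsDeformation F)
    (hG : IsDeformation G) (θ : F ⟶ G) :
    IsIso (hF.tangentMap hG θ) ↔ ∀ n, Function.Bijective (θ.app (shift K n)) := by
  rw [isIso_pi_iff]
  have h : ∀ i, IsIso (hF.tangentMap hG θ i) ↔
      Function.Bijective (θ.app (shift K (i + 1 - 1))) := fun i => by
    rw [ConcreteCategory.isIso_iff_bijective]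
    exact Iff.rfl
  simp only [h]
  refine ⟨fun H n => ?_, fun H i => H _⟩
  -- The degree `i` part of `TF[1]` is `F(K[i + 1 - 1])`; the index is kept unreduced so that no
  -- transport between objects is needed.
  obtain ⟨i, rfl⟩ : ∃ i, n = i + 1 - 1 := ⟨n, by omega⟩
  exact H i

end ExtDef

theorem theorem3p1 {K : Type u} [Field K] [CharZero K] :
    (∀ (F G : ExtDef.NilpDGA K ⥤ Type v), ExtDef.IsPredeformation F → ExtDef.IsPredeformation G →
      ∀ θ : F ⟶ G, IsIso θ ↔
        ∀ A : ExtDef.NilpDGA K, A.IsComplex → Function.Bijective (θ.app A)) ∧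
    (∀ (F G : ExtDef.NilpDGA K ⥤ Type v) (hF : ExtDef.IsDeformation F)
      (hG : ExtDef.IsDeformation G) (θ : F ⟶ G),
      IsIso θ ↔ IsIso (hF.tangentMap hG θ)) := by
  refine ⟨fun F G hF hG θ => ?_, fun F G hF hG θ => ?_⟩
  · rw [ExtDef.isIso_iff_bijective_app]
    exact ⟨fun h A _ => h A, hF.bijective_app hG θ⟩
  · rw [ExtDef.isIso_iff_bijective_app, hF.isIso_tangentMap_iff hG]
    exact ⟨fun h n => h _, fun h => hF.bijective_app hG.toIsPredeformation θ
      (hF.bijective_of_isComplex hG θ h)⟩
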